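/- Let $G=(V,E)$ be a finite connected (simple) graph of girth at least $6$ (trees, which have no cycles, are allowed). For $r\in\mathbb R^E$ let $\omega_e=e^{r_e}$ be the corresponding positive weight, let $m(x)=\sum_{e\ni x}\omega_e$, and for an edge $e$ with endpoints $x,y$ put $$\kappa_e(r)=2\omega_e\Big(\frac1{m(x)}+\frac1{m(y)}\Big)-2 .$$ This is the Lin–Lu–Yau curvature: for every $r$ and every edge $e=xy$, $$\kappa_e(r)=\lim_{\alpha\to1^-}\frac1{1-\alpha}\Big(1-\frac{W(m_x^\alpha,m_y^\alpha)}{d(x,y)}\Big),$$ where $d$ is the combinatorial graph distance, $W$ is the Wasserstein distance for $d$, and $m_x^\alpha$ is the probability measure with mass $\alpha$ at $x$ and mass $(1-\alpha)\omega_{xz}/m(x)$ at each neighbour $z$ of $x$. Let $J(r)=(\partial\kappa_i/\partial r_j)_{i,j\in E}$, a symmetric positive semidefinite matrix, and for $g\in\mathbb R^E$, $s\in\mathbb R$ and $p>1$ let $$\Delta g=-J g,\qquad \Delta^s g=-J^s g,\qquad (\Delta_p g)_i=\sum_{j\sim i}\Big(-\frac{\partial\kappa_i}{\partial r_j}\Big)|g_j-g_i|^{p-2}(g_j-g_i),$$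 where $J^s$ is defined by applying $\lambda\mapsto\lambda^s$ to the eigenvalues of $J$, with the convention $0^s=0$ for all $s\in\mathbb R$, where $j\sim i$ means that $i\ne j$ are edges with a common endpoint, and where terms with $g_j=g_i$ are $0$. Let $\kappa^*\in\mathbb R^E$ satisfy $\sum_{e}\kappa^*_e=2(|V|-|E|)$ and let $r_0\in\mathbb R^E$ be an arbitrary initial value. Then the following are equivalent: (i) there is $r^*\in\mathbb R^E$ with $\kappa(r^*)=\kappa^*$; (ii) the solution of the modified Calabi flow $r'=\Delta(\kappa-\kappa^*)$, $r(0)=r_0$, exists for all time and converges exponentially fast to some $r^*\in\mathbb R^E$; (iii) for every $s\in\mathbb R$, the solution of the $2s$-th order fractional Calabi flow $r'=\Delta^s(\kappa-\kappa^*)$, $r(0)=r_0$, exists for all time and converges exponentially fast to some $r^*\in\mathbb R^E$; (iv) for every $p>1$, the solution of the $p$-th Calabi flow $r'=\Delta_p(\kappa-\kappa^*)$, $r(0)=r_0$, exists for all time and converges to some $r^*\in\mathbb R^E$. Moreover the weight $r^*$ is the same throughout once it is normalized: for every fixed $r^*\in\mathbb R^E$ with $\sum_e r^*_e=\sum_e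 r_{0,e}$, the statements $\kappa(r^*)=\kappa^*$ and (ii), (iii), (iv) with this $r^*$ as the limit are equivalent. Here "the solution exists for all time" means that there is a solution on $[0,\infty)$ and that every solution on an interval $[0,T)$ extends to $[0,\infty)$; "converges to $r^*$" means that every solution on $[0,\infty)$ does; and "exponentially fast" means $\|r(t)-r^*\|\le Ce^{-ct}$ for all $t\ge0$, with constants $C,c>0$. -/

import Mathlib

open Filter Topology

namespace CalabiFlow

noncomputable section

variable {V : Type*} [Fintype V] [DecidableEq V] (G : SimpleGraph V) [DecidableRel G.Adj]

/-! ### Weights and curvature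

A positive weight `ω` on the edges is described by its logarithm `r`, that is `ω e = exp (r e)`. -/

/-- The positive edge weight `ω e = exp (r e)` with logarithm `r`. -/
def weight (r : G.edgeSet → ℝ) (e : G.edgeSet) : ℝ := Real.exp (r e)

/-- `m(x)`, the total weight of all edges incident to the vertex `x`. -/
def vertexWeight (r : G.edgeSet → ℝ) (x : V) : ℝ :=
  ∑ e : G.edgeSet with x ∈ e.1, weight G r e

/-- The curvature `κ_e = 2 ω_e (1 / m(x) + 1 / m(y)) - 2` of the edge `e` with endpoints `x`, `y`,
as a function of the logarithm `r` of the weight. -/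
def curvature (r : G.edgeSet → ℝ) (e : G.edgeSet) : ℝ :=
  2 * weight G r e * ∑ v : V with v ∈ e.1, 1 / vertexWeight G r v - 2

/-! ### The Lin-Lu-Yau curvature of a weighted graph -/

/-- The probability measure `m_x^α`: mass `α` at `x`, mass `(1 - α) ω_{xz} / m(x)` at each
neighbour `z` of `x`. -/
def walkMeasure (r : G.edgeSet → ℝ) (α : ℝ) (x z : V) : ℝ :=
  if z = x then α
  else if h : G.Adj x z then (1 - α) * weight G r ⟨s(x, z), h⟩ / vertexWeight G r x
  else 0

/-- `ρ` is a coupling of `μ` and `ν`. -/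
structure IsCoupling {V : Type*} [Fintype V] (μ ν : V → ℝ) (ρ : V → V → ℝ) : Prop where
  mem_Icc : ∀ x y, ρ x y ∈ Set.Icc (0 : ℝ) 1
  fst : ∀ x, ∑ y, ρ x y = μ x
  snd : ∀ y, ∑ x, ρ x y = ν y

/-- The Wasserstein distance of two probability measures on the vertices, for the standard
(combinatorial) graph distance. -/
def wasserstein {V : Type*} [Fintype V] (G : SimpleGraph V) (μ ν : V → ℝ) : ℝ :=
  sInf {c | ∃ ρ : V → V → ℝ, IsCoupling μ ν ρ ∧ c = ∑ x, ∑ y, ρ x y * (G.dist x y : ℝ)}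

/-- The number `k` is the Lin-Lu-Yau curvature of the pair `x`, `y` of vertices: the defining limit
exists and is equal to `k`. -/
def HasLinLuYauCurvature (r : G.edgeSet → ℝ) (x y : V) (k : ℝ) : Prop :=
  Tendsto
    (fun α : ℝ => 1 / (1 - α) *
      (1 - wasserstein G (walkMeasure G r α x) (walkMeasure G r α y) / (G.dist x y : ℝ)))
    (𝓝[<] 1) (𝓝 k)

/-! ### Laplace operators -/

/-- The Jacobian matrix `∂ κ_i / ∂ r_j`. -/
def jacobian (r : G.edgeSet → ℝ) : Matrix G.edgeSet G.edgeSet ℝ :=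
  Matrix.of fun i j => fderiv ℝ (curvature G) r (Pi.single j 1) i

/-- The discrete Laplace operator `(Δ g)_i = - ∑ j, (∂ κ_i / ∂ r_j) g_j` at `r`. -/
def laplace (r g : G.edgeSet → ℝ) : G.edgeSet → ℝ :=
  fun i => -∑ j, jacobian G r i j * g j

/-- The power `x ^ s` with the convention `0 ^ s = 0` for every real `s` (also for `s = 0`). -/
def powZero (s x : ℝ) : ℝ := if x = 0 then 0 else x ^ s

/-- The real power `J ^ s` of the symmetric positive semidefinite matrix `J`, by applying `powZero s`
to the eigenvalues in a spectral decomposition (functional calculus). -/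
def jacobianPow (r : G.edgeSet → ℝ) (s : ℝ) : Matrix G.edgeSet G.edgeSet ℝ :=
  cfc (powZero s) (jacobian G r)

/-- The `2s`-th order fractional discrete Laplace operator `Δ^s = - J ^ s` at `r`. -/
def fracLaplace (s : ℝ) (r g : G.edgeSet → ℝ) : G.edgeSet → ℝ :=
  -(Matrix.mulVec (jacobianPow G r s) g)

open Classical in
/-- The discrete `p`-Laplacian
`(Δ_p g)_i = ∑_{j ∼ i} (- ∂ κ_i / ∂ r_j) |g_j - g_i| ^ (p - 2) (g_j - g_i)` at `r`, where `j ∼ i`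
means that `i` and `j` are distinct edges with a common endpoint. -/
def pLaplace (p : ℝ) (r g : G.edgeSet → ℝ) : G.edgeSet → ℝ :=
  fun i => ∑ j : G.edgeSet with G.lineGraph.Adj i j,
    -jacobian G r i j * |g j - g i| ^ (p - 2) * (g j - g i)

/-! ### The flows, as vector fields on the space of logarithmic weights -/

/-- Modified Calabi flow: `r' = Δ (κ - κ*)`. -/
def calabiField (κs : G.edgeSet → ℝ) (r : G.edgeSet → ℝ) : G.edgeSet → ℝ :=
  laplace G r (curvature G r - κs)

/-- `2s`-th order fractional Calabi flow: `r' = Δ^s (κ - κ*)`. -/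
def fracCalabiField (s : ℝ) (κs : G.edgeSet → ℝ) (r : G.edgeSet → ℝ) : G.edgeSet → ℝ :=
  fracLaplace G s r (curvature G r - κs)

/-- `p`-th Calabi flow: `r' = Δ_p (κ - κ*)`. -/
def pCalabiField (p : ℝ) (κs : G.edgeSet → ℝ) (r : G.edgeSet → ℝ) : G.edgeSet → ℝ :=
  pLaplace G p r (curvature G r - κs)

/-! ### Solutions, long time existence, convergence -/

section ODE

variable {ι : Type*} [Fintype ι]

/-- `r` solves the initial value problem `r' = F r`, `r 0 = r₀` on the time interval `I`
(used for `I = [0, T)` and `I = [0, ∞)`; the derivative at `0` is one-sided). -/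
structure IsSolutionOn (F : (ι → ℝ) → (ι → ℝ)) (r₀ : ι → ℝ) (I : Set ℝ) (r : ℝ → ι → ℝ) :
    Prop where
  init : r 0 = r₀
  deriv : ∀ t ∈ I, HasDerivWithinAt r (F (r t)) I t

/-- The solution of `r' = F r`, `r 0 = r₀` exists for all time: there is a solution on `[0, ∞)`, and
no solution breaks down in finite time, i.e. each one on some `[0, T)` extends to `[0, ∞)`. -/
def ExistsForAllTime (F : (ι → ℝ) → (ι → ℝ)) (r₀ : ι → ℝ) : Prop :=
  (∃ r, IsSolutionOn F r₀ (Set.Ici 0) r) ∧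
    ∀ T : ℝ, 0 < T → ∀ r, IsSolutionOn F r₀ (Set.Ico 0 T) r →
      ∃ r', IsSolutionOn F r₀ (Set.Ici 0) r' ∧ Set.EqOn r r' (Set.Ico 0 T)

/-- The solution exists for all time and converges to `rs` as `t → ∞`. -/
def ConvergesTo (F : (ι → ℝ) → (ι → ℝ)) (r₀ rs : ι → ℝ) : Prop :=
  ExistsForAllTime F r₀ ∧
    ∀ r, IsSolutionOn F r₀ (Set.Ici 0) r → Tendsto r atTop (𝓝 rs)

/-- The solution exists for all time and converges exponentially fast to `rs`. (All norms on the
finite-dimensional space `ι → ℝ` are equivalent, so the choice of norm only affects `C`.) -/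
def ConvergesExpTo (F : (ι → ℝ) → (ι → ℝ)) (r₀ rs : ι → ℝ) : Prop :=
  ExistsForAllTime F r₀ ∧
    ∀ r, IsSolutionOn F r₀ (Set.Ici 0) r →
      ∃ C c : ℝ, 0 < C ∧ 0 < c ∧ ∀ t : ℝ, 0 ≤ t → ‖r t - rs‖ ≤ C * Real.exp (-c * t)

end ODE

end

end CalabiFlow

/-! For a vertex `v` the shares ω_i / m(v) of the edges at `v` form a probability vector, and κ_i +
2 is twice the sum of the shares of i at its endpoints. As shares are the partial derivatives of log
m(v), the field κ - κ* is the gradient of Ψ(r) = 2 Σ_v log m(v) - Σ_i (2 + κ*_i) r_i. Its Hessian is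
J, and h · J h = Σ_v Σ_{i,j} share_i share_j (h_i - h_j)², a sum of variances up to a factor. So Ψ
is convex, and since G is connected the kernel of J consists of the constants: Ψ is strictly convex
on each hyperplane of fixed coordinate sum. If κ* is attained, a translate of the realizing weight
along the constants is the unique minimizer r* in the hyperplane of r_0, and Ψ is proper there.

All the flows preserve the coordinate sum and do not increase Ψ: with g = κ - κ*, the dissipation is
g · J^s g for the fractional flows and a p-Dirichlet energy of g for the p-th flow. Solutions
therefore stay in a compact sublevel set, which gives long-time existence. The condition on Σ κ*
puts g orthogonal to the constants, where J^s is positive definite; with strong convexity this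
bounds the dissipation below by a multiple of Ψ - Ψ(r*), hence exponential decay. For the p-th flow
the dissipation is only known to be nonzero away from r*, which still gives convergence by
compactness. The p-th field may fail to be Lipschitz for p < 2, so existence rests on Peano's
theorem and the convergence arguments treat every solution, without uniqueness.

Conversely, s = 1 and p = 2 both give the Calabi flow; the limit of a solution is a zero of the
field, and J g = 0 with Σ g = 0 forces g = 0.

The identification with the Lin-Lu-Yau curvature is separate: girth at least 6 makes every path x',
x, y, y' geodesic, so an explicit Kantorovich potential and transport plan certify W = 1 - (1 - α) κ
exactly for α near 1. -/

namespace CalabiFlow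

/-! ### Peano's existence theorem -/

section Peano

variable {E : Type*} [NormedAddCommGroup E] [NormedSpace ℝ E]

/-- The points of the explicit Euler scheme with step size `h`. -/
def eulerIter (F : E → E) (h : ℝ) (x₀ : E) : ℕ → E
  | 0 => x₀
  | k + 1 => eulerIter F h x₀ k + h • F (eulerIter F h x₀ k)

lemma norm_eulerIter_add_sub_le {F : E → E} {M : ℝ} (hM : ∀ x, ‖F x‖ ≤ M) {h : ℝ} (hh : 0 ≤ h)
    (x₀ : E) (j k : ℕ) :
    ‖eulerIter F h x₀ (j + k) - eulerIter F h x₀ j‖ ≤ k * h * M := by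
  induction k with
  | zero => simp
  | succ k ih =>
    have h1 : eulerIter F h x₀ (j + (k + 1)) - eulerIter F h x₀ j
        = (eulerIter F h x₀ (j + k) - eulerIter F h x₀ j)
          + h • F (eulerIter F h x₀ (j + k)) := by
      rw [← add_assoc, eulerIter]; abel
    rw [h1]
    refine (norm_add_le _ _).trans ?_
    rw [norm_smul, Real.norm_of_nonneg hh]
    have := mul_le_mul_of_nonneg_left (hM (eulerIter F h x₀ (j + k))) hh
    push_cast
    linarith

/-- While the polygon moves by at most δ, each step direction differs from the first by at most ε.
The bound depends on the elapsed time k h only, so it survives h → 0. -/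
lemma norm_eulerIter_add_sub_sub_le {F : E → E} {M : ℝ} (hM : ∀ x, ‖F x‖ ≤ M) {h : ℝ}
    (hh : 0 ≤ h) {ε δ : ℝ} (hδ : ∀ x y, ‖x - y‖ ≤ δ → ‖F x - F y‖ ≤ ε)
    (x₀ : E) (j k : ℕ) (hk : k * h * M ≤ δ) :
    ‖eulerIter F h x₀ (j + k) - eulerIter F h x₀ j - ((k : ℝ) * h) • F (eulerIter F h x₀ j)‖
      ≤ k * h * ε := by
  have hM0 : 0 ≤ M := (norm_nonneg _).trans (hM x₀)
  induction k with
  | zero => simp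
  | succ k ih =>
    push_cast at hk
    have hk' : k * h * M ≤ δ := by nlinarith [mul_nonneg hh hM0]
    have h1 : eulerIter F h x₀ (j + (k + 1)) - eulerIter F h x₀ j
          - (((k + 1 : ℕ) : ℝ) * h) • F (eulerIter F h x₀ j)
        = (eulerIter F h x₀ (j + k) - eulerIter F h x₀ j
            - ((k : ℝ) * h) • F (eulerIter F h x₀ j))
          + h • (F (eulerIter F h x₀ (j + k)) - F (eulerIter F h x₀ j)) := by
      rw [← add_assoc, eulerIter]; push_cast; rw [add_mul, add_smul, one_mul, smul_sub]; abel
    rw [h1]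
    refine (norm_add_le _ _).trans ?_
    rw [norm_smul, Real.norm_of_nonneg hh]
    have h2 := hδ _ _ ((norm_eulerIter_add_sub_le hM hh x₀ j k).trans hk')
    have := mul_le_mul_of_nonneg_left h2 hh
    have := ih hk'
    push_cast
    linarith

/-- **Peano existence theorem** for a bounded uniformly continuous vector field. -/
theorem exists_hasDerivWithinAt_of_uniformContinuous [ProperSpace E] {F : E → E}
    (hF : UniformContinuous F) {M : ℝ} (hM : ∀ x, ‖F x‖ ≤ M) (x₀ : E) :
    ∃ r : ℝ → E, r 0 = x₀ ∧ ∀ t ∈ Set.Ici (0 : ℝ),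
      HasDerivWithinAt r (F (r t)) (Set.Ici 0) t := by
  have hM0 : 0 ≤ M := (norm_nonneg _).trans (hM x₀)
  let st : ℕ → ℝ := fun n => 1 / ((n : ℝ) + 1)
  have hst : ∀ n, 0 ≤ st n := fun n => by positivity
  let ix : ℕ → ℝ → ℕ := fun n t => ⌊t * ((n : ℝ) + 1)⌋₊
  let q : ℕ → ℝ → E := fun n t => eulerIter F (st n) x₀ (ix n t)
  -- A limit along an ultrafilter replaces Arzelà–Ascoli: bounded sequences converge along `U` at
  -- all times t simultaneously, with no subsequence to extract.
  let U : Ultrafilter ℕ := hyperfilter ℕ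
  have hU : (U : Filter ℕ) ≤ atTop := Nat.cofinite_eq_atTop ▸ hyperfilter_le_cofinite
  have hix : ∀ t : ℝ, 0 ≤ t → Tendsto (fun n => (ix n t : ℝ) * st n) U (𝓝 t) := by
    intro t ht
    have h1 : Tendsto (fun n : ℕ => (⌊t * ((n : ℝ) + 1)⌋₊ : ℝ) / ((n : ℝ) + 1)) atTop (𝓝 t) :=
      (tendsto_nat_floor_mul_div_atTop ht).comp
        (tendsto_atTop_add_const_right _ _ tendsto_natCast_atTop_atTop)
    refine (h1.mono_left hU).congr fun n => ?_
    simp only [ix, st]; ring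
  have hlim : ∀ t : ℝ, 0 ≤ t → ∃ y, Tendsto (fun n => q n t) U (𝓝 y) := by
    intro t ht
    have hb : ∀ n, q n t ∈ Metric.closedBall x₀ (t * M) := by
      intro n
      have h1 := norm_eulerIter_add_sub_le hM (hst n) x₀ 0 (ix n t)
      rw [zero_add] at h1
      have h2 : (ix n t : ℝ) * st n ≤ t := by
        have := Nat.floor_le (a := t * ((n : ℝ) + 1)) (by positivity)
        simp only [ix, st]
        rw [mul_one_div, div_le_iff₀ (by positivity)]
        exact this
      rw [mem_closedBall_iff_norm]
      exact h1.trans (mul_le_mul_of_nonneg_right h2 hM0)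
    obtain ⟨y, -, hy⟩ := (isCompact_closedBall x₀ (t * M)).ultrafilter_le_nhds
      (U.map fun n => q n t) (by
        rw [Ultrafilter.coe_map, Filter.le_principal_iff, Filter.mem_map]
        exact Filter.univ_mem' hb)
    exact ⟨y, hy⟩
  choose! r hr using hlim
  have key : ∀ ε δ : ℝ, (∀ x y, ‖x - y‖ ≤ δ → ‖F x - F y‖ ≤ ε) → ∀ s t : ℝ, 0 ≤ s → s ≤ t →
      (t - s) * M < δ → ‖r t - r s - (t - s) • F (r s)‖ ≤ (t - s) * ε := by
    intro ε δ hδ s t hs hst' hts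
    have ht := hs.trans hst'
    have hle : ∀ n, ix n s ≤ ix n t := fun n => by
      apply Nat.floor_le_floor
      gcongr
    have hk : Tendsto (fun n => ((ix n t - ix n s : ℕ) : ℝ) * st n) U (𝓝 (t - s)) := by
      refine ((hix t ht).sub (hix s hs)).congr fun n => ?_
      rw [Nat.cast_sub (hle n)]; ring
    have hL : Tendsto (fun n => ‖q n t - q n s - (((ix n t - ix n s : ℕ) : ℝ) * st n) • F (q n s)‖)
        U (𝓝 ‖r t - r s - (t - s) • F (r s)‖) :=
      (((hr t ht).sub (hr s hs)).sub
        (hk.smul ((hF.continuous.tendsto _).comp (hr s hs)))).norm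
    refine le_of_tendsto_of_tendsto hL (hk.mul_const ε) ?_
    filter_upwards [(hk.mul_const M).eventually (gt_mem_nhds hts)] with n hn
    have := norm_eulerIter_add_sub_sub_le hM (hst n) hδ x₀ (ix n s) (ix n t - ix n s) hn.le
    rwa [Nat.add_sub_cancel' (hle n)] at this
  refine ⟨r, ?_, ?_⟩
  · refine tendsto_nhds_unique (hr 0 le_rfl) ?_
    refine tendsto_const_nhds.congr fun n => ?_
    simp [q, ix, eulerIter]
  · intro t ht
    rw [hasDerivWithinAt_iff_isLittleO, Asymptotics.isLittleO_iff]
    intro c hc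
    obtain ⟨δ, hδ0, hδ⟩ := Metric.uniformContinuous_iff.1 hF (c / 2) (by positivity)
    have hδ' : ∀ x y, ‖x - y‖ ≤ δ / 2 → ‖F x - F y‖ ≤ c / 2 := by
      intro x y hxy
      rw [← dist_eq_norm] at hxy ⊢
      exact (hδ (by linarith)).le
    have hev : ∀ᶠ s in 𝓝[Set.Ici 0] t, |s - t| * (M + c) < δ / 2 := by
      apply nhdsWithin_le_nhds
      have hc : Continuous fun s : ℝ => |s - t| * (M + c) := by fun_prop
      refine (hc.tendsto t).eventually (gt_mem_nhds ?_)
      simp; linarith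
    filter_upwards [hev, self_mem_nhdsWithin] with s hs hs0
    rw [Real.norm_eq_abs]
    rcases le_total t s with h | h
    · rw [abs_of_nonneg (sub_nonneg.2 h)] at hs ⊢
      have h0 := sub_nonneg.2 h
      have := key _ _ hδ' t s ht h (by nlinarith)
      nlinarith
    -- `key` is based at the earlier time, here `s`. Replacing F (r s) by F (r t) costs the other
    -- half of `c`.
    · rw [abs_of_nonpos (sub_nonpos.2 h), neg_sub] at hs ⊢
      have h0 := sub_nonneg.2 h
      have h1 := key _ _ hδ' s t hs0 h (by nlinarith)
      have h2 : ‖r t - r s‖ ≤ (t - s) * (c / 2) + (t - s) * M := by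
        have e : r t - r s = (r t - r s - (t - s) • F (r s)) + (t - s) • F (r s) := by abel
        rw [e]
        refine (norm_add_le _ _).trans (add_le_add h1 ?_)
        rw [norm_smul, Real.norm_of_nonneg h0]
        exact mul_le_mul_of_nonneg_left (hM _) h0
      have h3 := hδ' (r t) (r s) (by nlinarith)
      have e : r s - r t - (s - t) • F (r t)
          = -(r t - r s - (t - s) • F (r s)) + (t - s) • (F (r t) - F (r s)) := by
        rw [smul_sub, sub_smul, sub_smul, sub_smul]; abel
      rw [e]
      refine (norm_add_le _ _).trans ?_
      rw [norm_neg, norm_smul, Real.norm_of_nonneg h0]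
      nlinarith [mul_le_mul_of_nonneg_left h3 h0]

end Peano

/-! ### Flows with a Lyapunov function -/

section Lyapunov

variable {ι : Type*} [Fintype ι]

/-- `g` is the gradient of `Ψ`, and `F` is a continuous vector field with zero coordinate sum along
which `Ψ` does not increase. -/
structure IsLyapunov (Ψ : (ι → ℝ) → ℝ) (g F : (ι → ℝ) → ι → ℝ) : Prop where
  grad : ∀ r, HasFDerivAt Ψ (∑ i, g r i • (ContinuousLinearMap.proj i : (ι → ℝ) →L[ℝ] ℝ)) r
  cont : Continuous F
  sum_eq_zero : ∀ r, ∑ i, F r i = 0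
  nonpos : ∀ r, ∑ i, g r i * F r i ≤ 0

/-- The points with the coordinate sum of `r₀` at which `Ψ` does not exceed its value at `r₀`. -/
def sublevel (Ψ : (ι → ℝ) → ℝ) (r₀ : ι → ℝ) : Set (ι → ℝ) :=
  {r | ∑ i, r i = ∑ i, r₀ i ∧ Ψ r ≤ Ψ r₀}

lemma self_mem_sublevel (Ψ : (ι → ℝ) → ℝ) (r₀ : ι → ℝ) : r₀ ∈ sublevel Ψ r₀ := ⟨rfl, le_rfl⟩

variable {Ψ : (ι → ℝ) → ℝ} {g F : (ι → ℝ) → ι → ℝ} {r₀ rs : ι → ℝ} {r : ℝ → ι → ℝ} {I : Set ℝ}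

namespace IsSolutionOn

lemma continuousOn (h : IsSolutionOn F r₀ I r) : ContinuousOn r I :=
  fun t ht => (h.deriv t ht).continuousWithinAt

lemma hasDerivWithinAt_comp (hg : ∀ r, HasFDerivAt Ψ
      (∑ i, g r i • (ContinuousLinearMap.proj i : (ι → ℝ) →L[ℝ] ℝ)) r)
    (h : IsSolutionOn F r₀ I r) {t : ℝ} (ht : t ∈ I) :
    HasDerivWithinAt (fun t => Ψ (r t)) (∑ i, g (r t) i * F (r t) i) I t := by
  refine ((hg (r t)).comp_hasDerivWithinAt t (h.deriv t ht)).congr_deriv ?_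
  simp [sum_apply]

lemma antitoneOn (hL : IsLyapunov Ψ g F) (h : IsSolutionOn F r₀ I r) (hI : Convex ℝ I) :
    AntitoneOn (fun t => Ψ (r t)) I :=
  antitoneOn_of_hasDerivWithinAt_nonpos hI
    (fun _ ht => (h.hasDerivWithinAt_comp hL.grad ht).continuousWithinAt)
    (fun _ ht => (h.hasDerivWithinAt_comp hL.grad (interior_subset ht)).mono interior_subset)
    fun _ _ => hL.nonpos _

lemma sum_eq (hL : IsLyapunov Ψ g F) (h : IsSolutionOn F r₀ I r) (hI : Convex ℝ I)
    (h0 : (0 : ℝ) ∈ I) {t : ℝ} (ht : t ∈ I) : ∑ i, r t i = ∑ i, r₀ i := by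
  have hd : ∀ t ∈ I, HasDerivWithinAt (fun t => ∑ i, r t i) 0 I t := by
    intro t ht
    rw [← hL.sum_eq_zero (r t)]
    exact HasDerivWithinAt.fun_sum fun i _ => hasDerivWithinAt_pi.1 (h.deriv t ht) i
  have := hI.norm_image_sub_le_of_norm_hasDerivWithin_le (C := 0) hd (by simp) h0 ht
  rw [← h.init]
  rw [zero_mul, norm_le_zero_iff, sub_eq_zero] at this
  exact this

lemma mem_sublevel (hL : IsLyapunov Ψ g F) (h : IsSolutionOn F r₀ I r) (hI : Convex ℝ I)
    (h0 : (0 : ℝ) ∈ I) {t : ℝ} (ht : t ∈ I) (ht0 : 0 ≤ t) : r t ∈ sublevel Ψ r₀ :=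
  ⟨h.sum_eq hL hI h0 ht, by simpa [h.init] using h.antitoneOn hL hI h0 ht ht0⟩

end IsSolutionOn

lemma exists_bound_of_isCompact {K : Set (ι → ℝ)} (hK : IsCompact K) (hF : Continuous F) :
    ∃ M : NNReal, ∀ x ∈ K, ‖F x‖₊ ≤ M := by
  obtain ⟨M, hM⟩ := hK.exists_bound_of_continuousOn hF.continuousOn
  exact ⟨M.toNNReal, fun x hx => by
    rw [← NNReal.coe_le_coe, coe_nnnorm]
    exact (hM x hx).trans (Real.le_coe_toNNReal M)⟩

/-- Existence for all time of some solution that starts in a compact sublevel set. -/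
theorem IsLyapunov.exists_isSolutionOn (hL : IsLyapunov Ψ g F)
    (hK : IsCompact (sublevel Ψ r₀)) : ∃ r, IsSolutionOn F r₀ (Set.Ici 0) r := by
  obtain ⟨R, hR⟩ := hK.isBounded.exists_norm_le
  -- Multiplying F by a nonnegative cutoff keeps the Lyapunov property, so the truncated trajectory
  -- never leaves the sublevel set, where the cutoff equals 1.
  let χ : (ι → ℝ) → ℝ := fun x => max 0 (min 1 (R + 1 - ‖x‖))
  have hχ : Continuous χ := by fun_prop
  have hχ0 : ∀ x, 0 ≤ χ x := fun x => le_max_left _ _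
  let F' : (ι → ℝ) → ι → ℝ := fun x => χ x • F x
  have hF' : Continuous F' := hχ.smul hL.cont
  have hL' : IsLyapunov Ψ g F' := by
    refine ⟨hL.grad, hF', fun r => ?_, fun r => ?_⟩
    · simp [F', ← Finset.mul_sum, hL.sum_eq_zero]
    · have := mul_nonpos_of_nonneg_of_nonpos (hχ0 r) (hL.nonpos r)
      rw [Finset.mul_sum] at this
      refine le_of_eq_of_le (Finset.sum_congr rfl fun i _ => ?_) this
      simp only [F', Pi.smul_apply, smul_eq_mul]; ring
  have hsupp : HasCompactSupport F' := by
    refine HasCompactSupport.intro (isCompact_closedBall (0 : ι → ℝ) (R + 1)) fun x hx => ?_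
    have hx' : R + 1 < ‖x‖ := by simpa using hx
    have : χ x = 0 := max_eq_left ((min_le_right _ _).trans (by linarith))
    simp [F', this]
  obtain ⟨M, hM⟩ := hF'.bounded_above_of_compact_support hsupp
  obtain ⟨r, hr0, hr⟩ := exists_hasDerivWithinAt_of_uniformContinuous
    (hsupp.uniformContinuous_of_continuous hF') hM r₀
  have hsol : IsSolutionOn F' r₀ (Set.Ici 0) r := ⟨hr0, hr⟩
  refine ⟨r, hr0, fun t ht => ?_⟩
  have hmem := hR _ (hsol.mem_sublevel hL' (convex_Ici 0) Set.self_mem_Ici ht ht)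
  have h1 : χ (r t) = 1 := by
    simp only [χ]
    rw [min_eq_left (by linarith), max_eq_right zero_le_one]
  have := hr t ht
  rwa [show F' (r t) = F (r t) by simp only [F', h1, one_smul]] at this

/-- A solution that starts in a compact sublevel set does not break down in finite time. -/
theorem IsLyapunov.existsForAllTime (hL : IsLyapunov Ψ g F)
    (hK : IsCompact (sublevel Ψ r₀)) : ExistsForAllTime F r₀ := by
  refine ⟨hL.exists_isSolutionOn hK, fun T hT r hr => ?_⟩
  have hI := convex_Ico (𝕜 := ℝ) (0 : ℝ) T
  have h0 : (0 : ℝ) ∈ Set.Ico (0 : ℝ) T := ⟨le_rfl, hT⟩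
  have hmem : ∀ t ∈ Set.Ico (0 : ℝ) T, r t ∈ sublevel Ψ r₀ :=
    fun t ht => hr.mem_sublevel hL hI h0 ht ht.1
  obtain ⟨M, hM⟩ := exists_bound_of_isCompact hK hL.cont
  -- The speed is bounded on the sublevel set, so r is Lipschitz and has a limit at T. A solution
  -- restarted from that limit is glued on.
  obtain ⟨q, hqL, hqr⟩ := (hI.lipschitzOnWith_of_nnnorm_hasDerivWithin_le hr.deriv
    fun t ht => hM _ (hmem t ht)).extend_pi
  have hqc := hqL.continuous
  have hqT : q T ∈ sublevel Ψ r₀ := by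
    have hq : Tendsto q (𝓝[<] T) (𝓝 (q T)) := (hqc.tendsto T).mono_left nhdsWithin_le_nhds
    refine hK.isClosed.mem_of_tendsto hq ?_
    filter_upwards [Ico_mem_nhdsLT hT] with t ht
    rw [← hqr ht]
    exact hmem t ht
  have hKT : IsCompact (sublevel Ψ (q T)) := by
    have hΨc : Continuous Ψ := continuous_iff_continuousAt.2 fun x => (hL.grad x).continuousAt
    refine hK.of_isClosed_subset ?_ fun x hx => ⟨hx.1.trans hqT.1, hx.2.trans hqT.2⟩
    exact (isClosed_eq (by fun_prop) continuous_const).inter (isClosed_le hΨc continuous_const)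
  obtain ⟨p, hp⟩ := hL.exists_isSolutionOn hKT
  let u : ℝ → ι → ℝ := fun t => if t < T then r t else p (t - T)
  have hul : ∀ t, t < T → u t = r t := fun t ht => if_pos ht
  have hur : ∀ t, T ≤ t → u t = p (t - T) := fun t ht => if_neg ht.not_gt
  have huT : u T = q T := by rw [hur T le_rfl, sub_self, hp.init]
  have hleft : ∀ t ∈ Set.Ico 0 T, HasDerivWithinAt u (F (u t)) (Set.Ici 0) t := by
    intro t ht
    have h1 := hr.deriv t ht
    rw [← Set.Ici_inter_Iio, hasDerivWithinAt_inter (Iio_mem_nhds ht.2)] at h1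
    rw [hul t ht.2]
    refine h1.congr_of_eventuallyEq ?_ (hul t ht.2)
    filter_upwards [nhdsWithin_le_nhds (Iio_mem_nhds ht.2)] with s hs using hul s hs
  have hright : ∀ t, T ≤ t → HasDerivWithinAt u (F (u t)) (Set.Ici T) t := by
    intro t ht
    have h1 := hp.deriv (t - T) (sub_nonneg.2 ht)
    have h2 : HasDerivWithinAt (fun s : ℝ => s - T) 1 (Set.Ici T) t :=
      ((hasDerivAt_id t).sub_const T).hasDerivWithinAt
    have h3 := h1.scomp t h2 (fun s hs => sub_nonneg.2 hs)
    rw [one_smul] at h3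
    rw [hur t ht]
    exact h3.congr (fun s hs => hur s hs) (hur t ht)
  refine ⟨u, ⟨by rw [hul 0 hT, hr.init], fun t ht => ?_⟩, fun t ht => (hul t ht.2).symm⟩
  rcases lt_trichotomy t T with h | h | h
  · exact hleft t ⟨ht, h⟩
  · subst h
    have hd : ∀ s ∈ Set.Ioo 0 t, HasDerivAt u (F (u s)) s := fun s hs =>
      (hleft s ⟨hs.1.le, hs.2⟩).hasDerivAt (Ici_mem_nhds hs.1)
    have huq : Set.EqOn u q (Set.Ioc 0 t) := by
      intro s hs
      rcases hs.2.eq_or_lt with rfl | h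
      · exact huT
      · rw [hul s h, hqr ⟨hs.1.le, h⟩]
    -- At the junction the left derivative exists because the derivatives F (q s) converge as s
    -- increases to the junction.
    have hlt : HasDerivWithinAt u (F (u t)) (Set.Iic t) t := by
      refine hasDerivWithinAt_Iic_of_tendsto_deriv (s := Set.Ioo 0 t)
        (fun s hs => (hd s hs).differentiableAt.differentiableWithinAt) ?_ (Ioo_mem_nhdsLT hT) ?_
      · exact hqc.continuousWithinAt.congr (fun s hs => huq ⟨hs.1, hs.2.le⟩) huT
      · have hq : Tendsto (fun s => F (q s)) (𝓝[<] t) (𝓝 (F (u t))) := by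
          rw [huT]
          exact ((hL.cont.comp hqc).tendsto t).mono_left nhdsWithin_le_nhds
        refine hq.congr' ?_
        filter_upwards [Ioo_mem_nhdsLT hT] with s hs
        rw [(hd s hs).deriv, huq ⟨hs.1, hs.2.le⟩]
    have := hlt.union (hright t le_rfl)
    rw [Set.Iic_union_Ici] at this
    exact this.mono (Set.subset_univ _)
  · exact ((hright t h.le).hasDerivAt (Ici_mem_nhds h)).hasDerivWithinAt

/-- Convergence to the unique minimizer if `Ψ` strictly decreases away from it. -/
theorem IsLyapunov.convergesTo (hL : IsLyapunov Ψ g F) (hg : Continuous g)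
    (hK : IsCompact (sublevel Ψ r₀))
    (hmin : ∀ r ∈ sublevel Ψ r₀, r ≠ rs → Ψ rs < Ψ r)
    (hneg : ∀ r ∈ sublevel Ψ r₀, r ≠ rs → ∑ i, g r i * F r i < 0) :
    ConvergesTo F r₀ rs := by
  refine ⟨hL.existsForAllTime hK, fun r hr => ?_⟩
  have hΨc : Continuous Ψ := continuous_iff_continuousAt.2 fun x => (hL.grad x).continuousAt
  have hmem : ∀ t, 0 ≤ t → r t ∈ sublevel Ψ r₀ := fun t ht =>
    hr.mem_sublevel hL (convex_Ici 0) Set.self_mem_Ici ht ht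
  have hFc := hL.cont
  have hlt : ∀ a, Ψ rs < a → ∃ T, 0 ≤ T ∧ ∀ t, T ≤ t → Ψ (r t) < a := by
    intro a ha
    suffices h : ∃ T, 0 ≤ T ∧ Ψ (r T) < a by
      obtain ⟨T, hT, hT'⟩ := h
      exact ⟨T, hT, fun t ht =>
        (hr.antitoneOn hL (convex_Ici 0) hT (hT.trans ht) ht).trans_lt hT'⟩
    by_contra! hcon
    have hcomp : IsCompact (sublevel Ψ r₀ ∩ {x | a ≤ Ψ x}) :=
      hK.inter_right (isClosed_le continuous_const hΨc)
    -- If Ψ stayed above a > Ψ rs, the dissipation would be at most its maximum δ < 0 on this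
    -- compact set, and Ψ would fall at least linearly.
    obtain ⟨x, hx, hxmax⟩ := hcomp.exists_isMaxOn ⟨r 0, hmem 0 le_rfl, hcon 0 le_rfl⟩
      (f := fun x => ∑ i, g x i * F x i) (by fun_prop)
    set δ := ∑ i, g x i * F x i with hδ
    have hδ0 : δ < 0 := hneg x hx.1 (by rintro rfl; exact absurd hx.2 (not_le.2 ha))
    have hd : ∀ t ∈ Set.Ici (0 : ℝ), HasDerivWithinAt (fun t => Ψ (r t) - δ * t)
        ((∑ i, g (r t) i * F (r t) i) - δ) (Set.Ici 0) t := fun t ht =>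
      ((hr.hasDerivWithinAt_comp hL.grad ht).fun_sub
        ((hasDerivWithinAt_id t (Set.Ici 0)).const_mul δ)).congr_deriv (by simp)
    have hanti : AntitoneOn (fun t => Ψ (r t) - δ * t) (Set.Ici 0) :=
      antitoneOn_of_hasDerivWithinAt_nonpos (convex_Ici 0)
        (fun t ht => (hd t ht).continuousWithinAt)
        (fun t ht => (hd t (interior_subset ht)).mono interior_subset)
        fun t ht => sub_nonpos.2 (hxmax ⟨hmem t (interior_subset ht), hcon t (interior_subset ht)⟩)
    -- The time at which the line Ψ (r 0) + δ t reaches a - 1.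
    have hT : 0 ≤ (a - Ψ (r 0) - 1) / δ :=
      div_nonneg_of_nonpos (by linarith [hcon 0 le_rfl]) hδ0.le
    have h1 := hanti Set.self_mem_Ici hT hT
    have h2 := hcon _ hT
    simp only [mul_div_cancel₀ _ hδ0.ne, mul_zero] at h1
    linarith
  rw [tendsto_nhds]
  intro U hU hrsU
  rcases (sublevel Ψ r₀ \ U).eq_empty_or_nonempty with hemp | hne
  · filter_upwards [eventually_ge_atTop 0] with t ht
    by_contra h
    exact (hemp ▸ (⟨hmem t ht, h⟩ : r t ∈ sublevel Ψ r₀ \ U) : r t ∈ (∅ : Set (ι → ℝ)))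
  · obtain ⟨x, hx, hxmin⟩ := (hK.diff hU).exists_isMinOn hne hΨc.continuousOn
    obtain ⟨T, hT0, hT⟩ := hlt _ (hmin x hx.1 (by rintro rfl; exact hx.2 hrsU))
    filter_upwards [eventually_ge_atTop T] with t ht
    by_contra h
    exact (hT t ht).not_ge (hxmin ⟨hmem t (hT0.trans ht), h⟩)

/-- Exponential convergence if the dissipation controls `Ψ`, and `Ψ` controls the distance. -/
theorem IsLyapunov.convergesExpTo (hL : IsLyapunov Ψ g F) (hK : IsCompact (sublevel Ψ r₀))
    {c μ : ℝ} (hc : 0 < c) (hμ : 0 < μ)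
    (hmin : ∀ r ∈ sublevel Ψ r₀, μ * ‖r - rs‖ ^ 2 ≤ Ψ r - Ψ rs)
    (hneg : ∀ r ∈ sublevel Ψ r₀, ∑ i, g r i * F r i ≤ -c * (Ψ r - Ψ rs)) :
    ConvergesExpTo F r₀ rs := by
  refine ⟨hL.existsForAllTime hK, fun r hr => ?_⟩
  have hmem : ∀ t, 0 ≤ t → r t ∈ sublevel Ψ r₀ := fun t ht =>
    hr.mem_sublevel hL (convex_Ici 0) Set.self_mem_Ici ht ht
  have hd : ∀ t ∈ Set.Ici (0 : ℝ), HasDerivWithinAt (fun t => (Ψ (r t) - Ψ rs) * Real.exp (c * t))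
      ((∑ i, g (r t) i * F (r t) i) * Real.exp (c * t)
        + (Ψ (r t) - Ψ rs) * (Real.exp (c * t) * c)) (Set.Ici 0) t := fun t ht => by
    have h1 : HasDerivAt (fun t => Real.exp (c * t)) (Real.exp (c * t) * c) t := by
      simpa using ((hasDerivAt_id t).const_mul c).exp
    exact ((hr.hasDerivWithinAt_comp hL.grad ht).sub_const _).mul h1.hasDerivWithinAt
  have hanti : AntitoneOn (fun t => (Ψ (r t) - Ψ rs) * Real.exp (c * t)) (Set.Ici 0) :=
    antitoneOn_of_hasDerivWithinAt_nonpos (convex_Ici 0)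
      (fun t ht => (hd t ht).continuousWithinAt)
      (fun t ht => (hd t (interior_subset ht)).mono interior_subset)
      fun t ht => by
        have := hneg _ (hmem t (interior_subset ht))
        have := mul_le_mul_of_nonneg_right this (Real.exp_pos (c * t)).le
        linarith
  have hA : 0 ≤ Ψ r₀ - Ψ rs :=
    (by positivity : (0 : ℝ) ≤ μ * ‖r₀ - rs‖ ^ 2).trans (hmin r₀ (self_mem_sublevel _ _))
  -- The rate is halved since Ψ controls the square of the distance; the summand 1 keeps the
  -- constant positive when r₀ = rs.
  refine ⟨√((Ψ r₀ - Ψ rs) / μ) + 1, c / 2, by positivity, by positivity, fun t ht => ?_⟩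
  have h1 := hanti Set.self_mem_Ici ht ht
  simp only [hr.init, mul_zero, Real.exp_zero, mul_one] at h1
  have h2 := hmin _ (hmem t ht)
  set e := Real.exp (-(c / 2) * t) with he
  have he0 : 0 < e := Real.exp_pos _
  have hee : Real.exp (c * t) * e ^ 2 = 1 := by
    rw [he, ← Real.exp_nat_mul, ← Real.exp_add, Real.exp_eq_one_iff]; push_cast; ring
  have h3 : ‖r t - rs‖ ^ 2 ≤ (√((Ψ r₀ - Ψ rs) / μ) * e) ^ 2 := by
    rw [mul_pow, Real.sq_sqrt (by positivity), div_mul_eq_mul_div, le_div_iff₀ hμ]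
    have := mul_le_mul_of_nonneg_right h1 (sq_nonneg e)
    rw [mul_assoc, hee] at this
    linarith
  have h4 := le_trans (le_abs_self _) (abs_le_of_sq_le_sq h3 (by positivity))
  nlinarith

/-- The limit of a solution is an equilibrium. -/
theorem IsSolutionOn.eq_zero_of_tendsto (hF : Continuous F) (hr : IsSolutionOn F r₀ (Set.Ici 0) r)
    (hlim : Tendsto r atTop (𝓝 rs)) : F rs = 0 := by
  rw [← norm_le_zero_iff]
  refine le_of_forall_pos_le_add fun ε hε => ?_
  have hev : ∀ᶠ t in atTop, ‖F (r t) - F rs‖ ≤ ε := by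
    have : Tendsto (fun t => ‖F (r t) - F rs‖) atTop (𝓝 0) := by
      simpa using (((hF.tendsto rs).comp hlim).sub_const (F rs)).norm
    filter_upwards [this.eventually (gt_mem_nhds hε)] with t ht using ht.le
  obtain ⟨T, hT⟩ := eventually_atTop.1 hev
  -- Late unit-time increments are close to F rs, yet they tend to 0 because r converges.
  have hstep : ∀ t, max T 0 ≤ t → ‖r (t + 1) - r t - F rs‖ ≤ ε := by
    intro t ht
    have hsub : Set.Ici t ⊆ Set.Ici 0 := Set.Ici_subset_Ici.2 ((le_max_right _ _).trans ht)
    have hd : ∀ s ∈ Set.Ici t, HasDerivWithinAt (fun s => r s - s • F rs)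
        (F (r s) - F rs) (Set.Ici t) s := fun s hs =>
      (((hr.deriv s (hsub hs)).mono hsub).fun_sub
        ((hasDerivWithinAt_id s (Set.Ici t)).smul_const (F rs))).congr_deriv (by simp)
    have := (convex_Ici t).norm_image_sub_le_of_norm_hasDerivWithin_le hd
      (fun s hs => hT s (((le_max_left _ _).trans ht).trans hs)) Set.self_mem_Ici
      (show t + 1 ∈ Set.Ici t by simp)
    have e : r (t + 1) - (t + 1) • F rs - (r t - t • F rs) = r (t + 1) - r t - F rs := by
      rw [add_smul, one_smul]; abel
    rw [e] at this
    simpa using this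
  have hl : Tendsto (fun t => ‖r (t + 1) - r t - F rs‖) atTop (𝓝 ‖rs - rs - F rs‖) :=
    (((hlim.comp (tendsto_atTop_add_const_right _ 1 tendsto_id)).sub hlim).sub_const _).norm
  have := le_of_tendsto hl (by
    filter_upwards [eventually_ge_atTop (max T 0)] with t ht using hstep t ht)
  simpa using this

theorem ConvergesTo.eq_zero (hF : Continuous F) (h : ConvergesTo F r₀ rs) : F rs = 0 := by
  obtain ⟨⟨⟨r, hr⟩, -⟩, hlim⟩ := h
  exact hr.eq_zero_of_tendsto hF (hlim r hr)

theorem ConvergesExpTo.convergesTo (h : ConvergesExpTo F r₀ rs) : ConvergesTo F r₀ rs := by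
  refine ⟨h.1, fun r hr => ?_⟩
  obtain ⟨C, c, -, hc, hb⟩ := h.2 r hr
  rw [tendsto_iff_norm_sub_tendsto_zero]
  have h0 : Tendsto (fun t : ℝ => C * Real.exp (-c * t)) atTop (𝓝 0) := by
    have : Tendsto (fun t : ℝ => -c * t) atTop atBot :=
      tendsto_id.const_mul_atTop_of_neg (neg_neg_of_pos hc)
    simpa using (Real.tendsto_exp_atBot.comp this).const_mul C
  refine squeeze_zero' (Eventually.of_forall fun t => norm_nonneg _) ?_ h0
  filter_upwards [eventually_ge_atTop 0] with t ht using hb t ht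

end Lyapunov

/-! ### The derivative of the curvature and its potential -/

section Edges

variable {V : Type*} {G : SimpleGraph V}

lemma weight_pos (r : G.edgeSet → ℝ) (e : G.edgeSet) : 0 < weight G r e := Real.exp_pos _

/-- A function on the edges of a connected graph that agrees on edges with a common endpoint is
constant. -/
lemma eq_of_forall_mem_eq (hconn : G.Connected) {α : Type*} {h : G.edgeSet → α}
    (hh : ∀ (e f : G.edgeSet) (v : V), v ∈ e.1 → v ∈ f.1 → h e = h f) (e f : G.edgeSet) :
    h e = h f := by
  have key : ∀ u w : V, G.Walk u w → ∀ e f : G.edgeSet, u ∈ e.1 → w ∈ f.1 → h e = h f := by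
    intro u w p
    induction p with
    | nil => exact fun e f => hh e f _
    | @cons u x w hux p ih =>
      intro e f he hf
      rw [hh e ⟨s(u, x), hux⟩ u he (Sym2.mem_mk_left u x)]
      exact ih _ f (Sym2.mem_mk_right u x) hf
  obtain ⟨u, hu⟩ : ∃ u, u ∈ e.1 := ⟨_, Sym2.out_fst_mem e.1⟩
  obtain ⟨w, hw⟩ : ∃ w, w ∈ f.1 := ⟨_, Sym2.out_fst_mem f.1⟩
  exact key u w (hconn.preconnected u w).some e f hu hw

end Edges

lemma eq_zero_of_sum_eq_zero {ι : Type*} [Fintype ι] {h : ι → ℝ} (hc : ∀ i j, h i = h j)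
    (hs : ∑ i, h i = 0) : h = 0 := by
  ext i
  rw [Finset.sum_congr rfl fun j _ => hc j i, Finset.sum_const, nsmul_eq_mul] at hs
  have : (Finset.univ.card : ℝ) ≠ 0 :=
    Nat.cast_ne_zero.2 (Finset.card_ne_zero_of_mem (Finset.mem_univ i))
  exact (mul_eq_zero.1 hs).resolve_left this

section Calculus

variable {V : Type*} [Fintype V] [DecidableEq V] {G : SimpleGraph V} [DecidableRel G.Adj]

/-- The share of the edge `i` in the total weight at the vertex `v`. -/
noncomputable def share (G : SimpleGraph V) [DecidableRel G.Adj] (r : G.edgeSet → ℝ) (v : V)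
    (i : G.edgeSet) : ℝ :=
  if v ∈ i.1 then weight G r i / vertexWeight G r v else 0

lemma vertexWeight_nonneg (r : G.edgeSet → ℝ) (v : V) : 0 ≤ vertexWeight G r v :=
  Finset.sum_nonneg fun _ _ => (weight_pos r _).le

lemma vertexWeight_pos (r : G.edgeSet → ℝ) {v : V} {e : G.edgeSet} (he : v ∈ e.1) :
    0 < vertexWeight G r v :=
  Finset.sum_pos (fun _ _ => weight_pos r _) ⟨e, by simpa using he⟩

lemma share_nonneg (r : G.edgeSet → ℝ) (v : V) (i : G.edgeSet) : 0 ≤ share G r v i := by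
  unfold share
  split_ifs
  · exact div_nonneg (weight_pos r i).le (vertexWeight_nonneg r v)
  · rfl

lemma share_pos (r : G.edgeSet → ℝ) {v : V} {i : G.edgeSet} (h : v ∈ i.1) :
    0 < share G r v i := by
  rw [share, if_pos h]
  exact div_pos (weight_pos r i) (vertexWeight_pos r h)

lemma sum_share (hG : ∀ v : V, ∃ e : G.edgeSet, v ∈ e.1) (r : G.edgeSet → ℝ) (v : V) :
    ∑ i, share G r v i = 1 := by
  obtain ⟨e, he⟩ := hG v
  simp only [share]
  rw [← Finset.sum_filter, ← Finset.sum_div]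
  exact div_self (vertexWeight_pos r he).ne'

lemma curvature_eq (r : G.edgeSet → ℝ) (i : G.edgeSet) :
    curvature G r i = 2 * ∑ v, share G r v i - 2 := by
  rw [curvature, mul_assoc, Finset.mul_sum, Finset.sum_filter]
  simp only [share, mul_one_div]

/-- Each vertex contributes total share 1. This is a discrete Gauss–Bonnet identity, and it is why
κ* must have the prescribed sum. -/
lemma sum_curvature (hG : ∀ v : V, ∃ e : G.edgeSet, v ∈ e.1) (r : G.edgeSet → ℝ) :
    ∑ i, curvature G r i = 2 * ((Fintype.card V : ℝ) - (Fintype.card G.edgeSet : ℝ)) := by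
  simp only [curvature_eq, Finset.sum_sub_distrib, ← Finset.mul_sum]
  rw [Finset.sum_comm]
  simp only [sum_share hG]
  simp
  ring

lemma hasFDerivAt_log_vertexWeight (hG : ∀ v : V, ∃ e : G.edgeSet, v ∈ e.1) (r : G.edgeSet → ℝ)
    (v : V) : HasFDerivAt (fun r => Real.log (vertexWeight G r v))
      (∑ i, share G r v i • (ContinuousLinearMap.proj i : (G.edgeSet → ℝ) →L[ℝ] ℝ)) r := by
  obtain ⟨e, he⟩ := hG v
  have h1 : HasFDerivAt (fun r => vertexWeight G r v)
      (∑ i : G.edgeSet with v ∈ i.1,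
        weight G r i • (ContinuousLinearMap.proj i : (G.edgeSet → ℝ) →L[ℝ] ℝ)) r :=
    HasFDerivAt.fun_sum fun i _ => (hasFDerivAt_apply i r).exp
  refine (h1.log (vertexWeight_pos r he).ne').congr_fderiv ?_
  rw [Finset.smul_sum, Finset.sum_filter]
  refine Finset.sum_congr rfl fun i _ => ?_
  simp only [share]
  split_ifs
  · rw [smul_smul, inv_mul_eq_div]
  · rw [zero_smul]

/-- A share is a softmax, exp (r_i - log m(v)), so its derivative is itself times its logarithmic
derivative. -/
lemma hasFDerivAt_share (hG : ∀ v : V, ∃ e : G.edgeSet, v ∈ e.1) (r : G.edgeSet → ℝ)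
    (v : V) (i : G.edgeSet) : HasFDerivAt (fun r => share G r v i)
      (share G r v i • ((ContinuousLinearMap.proj i : (G.edgeSet → ℝ) →L[ℝ] ℝ)
        - ∑ j, share G r v j • (ContinuousLinearMap.proj j : (G.edgeSet → ℝ) →L[ℝ] ℝ))) r := by
  by_cases hi : v ∈ i.1
  · have e : ∀ r, share G r v i = Real.exp (r i - Real.log (vertexWeight G r v)) := fun r => by
      rw [share, if_pos hi, Real.exp_sub, Real.exp_log (vertexWeight_pos r hi), weight]
    have := ((hasFDerivAt_apply i r).fun_sub (hasFDerivAt_log_vertexWeight hG r v)).exp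
    rw [← e] at this
    exact this.congr_of_eventuallyEq (Eventually.of_forall e)
  · simp only [share, if_neg hi, zero_smul]
    exact hasFDerivAt_const _ _

lemma hasFDerivAt_curvature_apply (hG : ∀ v : V, ∃ e : G.edgeSet, v ∈ e.1) (r : G.edgeSet → ℝ)
    (i : G.edgeSet) : HasFDerivAt (fun r => curvature G r i)
      ((2 : ℝ) • ∑ v, share G r v i • ((ContinuousLinearMap.proj i : (G.edgeSet → ℝ) →L[ℝ] ℝ)
        - ∑ j, share G r v j • (ContinuousLinearMap.proj j : (G.edgeSet → ℝ) →L[ℝ] ℝ))) r := by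
  simp only [curvature_eq]
  exact ((HasFDerivAt.fun_sum fun v _ => hasFDerivAt_share hG r v i).const_mul 2).sub_const 2

lemma hasFDerivAt_curvature (hG : ∀ v : V, ∃ e : G.edgeSet, v ∈ e.1) (r : G.edgeSet → ℝ) :
    HasFDerivAt (curvature G) (ContinuousLinearMap.pi fun i => (2 : ℝ) • ∑ v, share G r v i •
      ((ContinuousLinearMap.proj i : (G.edgeSet → ℝ) →L[ℝ] ℝ)
        - ∑ j, share G r v j • (ContinuousLinearMap.proj j : (G.edgeSet → ℝ) →L[ℝ] ℝ))) r :=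
  hasFDerivAt_pi.2 fun i => hasFDerivAt_curvature_apply hG r i

lemma jacobian_apply (hG : ∀ v : V, ∃ e : G.edgeSet, v ∈ e.1) (r : G.edgeSet → ℝ)
    (i j : G.edgeSet) : jacobian G r i j
      = 2 * ∑ v, share G r v i * ((if i = j then 1 else 0) - share G r v j) := by
  rw [jacobian, Matrix.of_apply, (hasFDerivAt_curvature hG r).fderiv]
  simp [sum_apply, Pi.single_apply]

lemma jacobian_mulVec (hG : ∀ v : V, ∃ e : G.edgeSet, v ∈ e.1) (r h : G.edgeSet → ℝ)
    (i : G.edgeSet) : (jacobian G r).mulVec h i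
      = 2 * ∑ v, share G r v i * (h i - ∑ j, share G r v j * h j) := by
  simp only [Matrix.mulVec, dotProduct, jacobian_apply hG, mul_assoc, Finset.sum_mul,
    ← Finset.mul_sum]
  rw [Finset.sum_comm]
  simp only [← Finset.mul_sum, sub_mul, Finset.sum_sub_distrib, ite_mul, one_mul, zero_mul,
    Finset.sum_ite_eq, Finset.mem_univ, if_true]

lemma jacobian_isSymm (hG : ∀ v : V, ∃ e : G.edgeSet, v ∈ e.1) (r : G.edgeSet → ℝ)
    (i j : G.edgeSet) : jacobian G r i j = jacobian G r j i := by
  rw [jacobian_apply hG, jacobian_apply hG]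
  by_cases h : i = j
  · subst h; rfl
  · simp [h, Ne.symm h, mul_comm]

lemma jacobian_mulVec_one (hG : ∀ v : V, ∃ e : G.edgeSet, v ∈ e.1) (r : G.edgeSet → ℝ) :
    (jacobian G r).mulVec 1 = 0 := by
  ext i
  simp [jacobian_mulVec hG, sum_share hG]

/-- The Jacobian acts on `h` by the sum over all vertices of the variances of `h`. -/
lemma dotProduct_jacobian_mulVec (hG : ∀ v : V, ∃ e : G.edgeSet, v ∈ e.1)
    (r h : G.edgeSet → ℝ) : h ⬝ᵥ (jacobian G r).mulVec h
      = ∑ v, ∑ i, ∑ j, share G r v i * share G r v j * (h i - h j) ^ 2 := by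
  simp only [dotProduct, jacobian_mulVec hG]
  have hv : ∀ v, ∑ i, ∑ j, share G r v i * share G r v j * (h i - h j) ^ 2
      = ∑ i, h i * (2 * (share G r v i * (h i - ∑ j, share G r v j * h j))) := by
    intro v
    have h1 := sum_share hG r v
    set m := ∑ j, share G r v j * h j with hm
    have e1 : ∀ i, ∑ j, share G r v i * share G r v j * (h i - h j) ^ 2
        = share G r v i * h i ^ 2 - 2 * m * (share G r v i * h i)
          + share G r v i * ∑ j, share G r v j * h j ^ 2 := by
      intro i
      have : ∀ j, share G r v i * share G r v j * (h i - h j) ^ 2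
          = share G r v i * h i ^ 2 * share G r v j
            - 2 * (share G r v i * h i) * (share G r v j * h j)
            + share G r v i * (share G r v j * h j ^ 2) := fun j => by ring
      simp only [this, Finset.sum_add_distrib, Finset.sum_sub_distrib, ← Finset.mul_sum, h1, ← hm]
      ring
    have e2 : ∀ i, h i * (2 * (share G r v i * (h i - m)))
        = 2 * (share G r v i * h i ^ 2) - 2 * m * (share G r v i * h i) := fun i => by ring
    simp only [e1, e2, Finset.sum_add_distrib, Finset.sum_sub_distrib, ← Finset.mul_sum,
      ← Finset.sum_mul, h1, ← hm]
    ring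
  simp only [hv]
  rw [Finset.sum_comm]
  simp only [← Finset.mul_sum]

lemma dotProduct_jacobian_mulVec_nonneg (hG : ∀ v : V, ∃ e : G.edgeSet, v ∈ e.1)
    (r h : G.edgeSet → ℝ) : 0 ≤ h ⬝ᵥ (jacobian G r).mulVec h := by
  rw [dotProduct_jacobian_mulVec hG]
  exact Finset.sum_nonneg fun v _ => Finset.sum_nonneg fun i _ => Finset.sum_nonneg fun j _ =>
    mul_nonneg (mul_nonneg (share_nonneg _ _ _) (share_nonneg _ _ _)) (sq_nonneg _)

/-- Every term of the variance formula must vanish, and shares at a common endpoint are positive;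
connectedness then propagates the equality. -/
lemma eq_of_dotProduct_jacobian_mulVec_eq_zero (hG : ∀ v : V, ∃ e : G.edgeSet, v ∈ e.1)
    (hconn : G.Connected) {r h : G.edgeSet → ℝ} (h0 : h ⬝ᵥ (jacobian G r).mulVec h = 0)
    (i j : G.edgeSet) : h i = h j := by
  refine eq_of_forall_mem_eq hconn (fun e f v he hf => ?_) i j
  rw [dotProduct_jacobian_mulVec hG] at h0
  have hn : ∀ v i j, 0 ≤ share G r v i * share G r v j * (h i - h j) ^ 2 := fun v i j =>
    mul_nonneg (mul_nonneg (share_nonneg _ _ _) (share_nonneg _ _ _)) (sq_nonneg _)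
  have h1 := (Finset.sum_eq_zero_iff_of_nonneg fun v _ => Finset.sum_nonneg fun i _ =>
    Finset.sum_nonneg fun j _ => hn v i j).1 h0 v (Finset.mem_univ _)
  have h2 := (Finset.sum_eq_zero_iff_of_nonneg fun i _ =>
    Finset.sum_nonneg fun j _ => hn v i j).1 h1 e (Finset.mem_univ _)
  have h3 := (Finset.sum_eq_zero_iff_of_nonneg fun j _ => hn v e j).1 h2 f (Finset.mem_univ _)
  have h4 := (mul_eq_zero.1 h3).resolve_left (mul_pos (share_pos r he) (share_pos r hf)).ne'
  exact sub_eq_zero.1 (pow_eq_zero_iff two_ne_zero |>.1 h4)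

lemma dotProduct_jacobian_mulVec_pos (hG : ∀ v : V, ∃ e : G.edgeSet, v ∈ e.1)
    (hconn : G.Connected) (r : G.edgeSet → ℝ) {h : G.edgeSet → ℝ} (hs : ∑ i, h i = 0)
    (h0 : h ≠ 0) : 0 < h ⬝ᵥ (jacobian G r).mulVec h :=
  (dotProduct_jacobian_mulVec_nonneg hG r h).lt_of_ne' fun he =>
    h0 (eq_zero_of_sum_eq_zero (eq_of_dotProduct_jacobian_mulVec_eq_zero hG hconn he) hs)

lemma continuous_share (hG : ∀ v : V, ∃ e : G.edgeSet, v ∈ e.1) (v : V) (i : G.edgeSet) :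
    Continuous fun r => share G r v i :=
  continuous_iff_continuousAt.2 fun r => (hasFDerivAt_share hG r v i).continuousAt

lemma continuous_curvature (hG : ∀ v : V, ∃ e : G.edgeSet, v ∈ e.1) : Continuous (curvature G) :=
  continuous_iff_continuousAt.2 fun r => (hasFDerivAt_curvature hG r).continuousAt

lemma continuous_jacobian (hG : ∀ v : V, ∃ e : G.edgeSet, v ∈ e.1) : Continuous (jacobian G) := by
  refine continuous_pi fun i => continuous_pi fun j => ?_
  simp only [jacobian_apply hG]
  have := continuous_share hG
  fun_prop

/-- The convex potential of the vector field `κ - κ*`. -/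
noncomputable def potential (G : SimpleGraph V) [DecidableRel G.Adj] (κs r : G.edgeSet → ℝ) : ℝ :=
  2 * ∑ v, Real.log (vertexWeight G r v) - ∑ i, (2 + κs i) * r i

lemma hasFDerivAt_potential (hG : ∀ v : V, ∃ e : G.edgeSet, v ∈ e.1) (κs r : G.edgeSet → ℝ) :
    HasFDerivAt (potential G κs) (∑ i, (curvature G r - κs) i •
      (ContinuousLinearMap.proj i : (G.edgeSet → ℝ) →L[ℝ] ℝ)) r := by
  have h1 := ((HasFDerivAt.fun_sum fun v (_ : v ∈ Finset.univ) =>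
    hasFDerivAt_log_vertexWeight hG r v).const_mul (2 : ℝ)).fun_sub
    (HasFDerivAt.fun_sum fun i (_ : i ∈ Finset.univ) =>
      (hasFDerivAt_apply i r).const_mul (2 + κs i))
  refine h1.congr_fderiv ?_
  rw [Finset.sum_comm]
  simp only [← Finset.sum_smul, Finset.smul_sum, ← Finset.sum_sub_distrib, smul_smul, ← sub_smul]
  refine Finset.sum_congr rfl fun i _ => ?_
  rw [Pi.sub_apply, curvature_eq]
  congr 1
  ring

lemma continuous_potential (hG : ∀ v : V, ∃ e : G.edgeSet, v ∈ e.1) (κs : G.edgeSet → ℝ) :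
    Continuous (potential G κs) :=
  continuous_iff_continuousAt.2 fun r => (hasFDerivAt_potential hG κs r).continuousAt

lemma hasDerivAt_potential_line (hG : ∀ v : V, ∃ e : G.edgeSet, v ∈ e.1)
    (κs a h : G.edgeSet → ℝ) (t : ℝ) : HasDerivAt (fun t : ℝ => potential G κs (a + t • h))
      ((curvature G (a + t • h) - κs) ⬝ᵥ h) t := by
  have hl : HasDerivAt (fun t : ℝ => a + t • h) h t := by
    simpa using ((hasDerivAt_id t).smul_const h).const_add a
  refine ((hasFDerivAt_potential hG κs _).comp_hasDerivAt t hl).congr_deriv ?_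
  simp [sum_apply, dotProduct]

lemma hasDerivAt_curvature_line (hG : ∀ v : V, ∃ e : G.edgeSet, v ∈ e.1)
    (κs a h : G.edgeSet → ℝ) (t : ℝ) :
    HasDerivAt (fun t : ℝ => (curvature G (a + t • h) - κs) ⬝ᵥ h)
      (h ⬝ᵥ (jacobian G (a + t • h)).mulVec h) t := by
  have hl : HasDerivAt (fun t : ℝ => a + t • h) h t := by
    simpa using ((hasDerivAt_id t).smul_const h).const_add a
  have h1 : ∀ i, HasDerivAt (fun t : ℝ => curvature G (a + t • h) i)
      ((jacobian G (a + t • h)).mulVec h i) t := by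
    intro i
    refine ((hasFDerivAt_curvature_apply hG _ i).comp_hasDerivAt t hl).congr_deriv ?_
    simp [sum_apply, jacobian_mulVec hG]
  have h2 := HasDerivAt.fun_sum fun i (_ : i ∈ Finset.univ) =>
    ((h1 i).sub_const (κs i)).mul_const (h i)
  refine h2.congr_deriv ?_
  simp [dotProduct, mul_comm]

/-- Estimates for a function on `[0, 1]` with critical point `0` and second derivative `≥ m`. -/
lemma le_of_second_deriv_ge {φ φ' φ'' : ℝ → ℝ} {m : ℝ} (h1 : ∀ t, HasDerivAt φ (φ' t) t)
    (h2 : ∀ t, HasDerivAt φ' (φ'' t) t) (h0 : φ' 0 = 0) (hm0 : 0 ≤ m)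
    (hm : ∀ t ∈ Set.Icc (0 : ℝ) 1, m ≤ φ'' t) :
    m / 2 ≤ φ 1 - φ 0 ∧ φ 1 - φ 0 ≤ φ' 1 ∧ m ≤ φ' 1 := by
  have hI : Convex ℝ (Set.Icc (0 : ℝ) 1) := convex_Icc 0 1
  have m0 : (0 : ℝ) ∈ Set.Icc (0 : ℝ) 1 := by simp
  have m1 : (1 : ℝ) ∈ Set.Icc (0 : ℝ) 1 := by simp
  have mono : ∀ {u u' : ℝ → ℝ}, (∀ t, HasDerivAt u (u' t) t) →
      (∀ t ∈ Set.Icc (0 : ℝ) 1, 0 ≤ u' t) → MonotoneOn u (Set.Icc 0 1) := fun hu hu' =>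
    monotoneOn_of_hasDerivWithinAt_nonneg hI (fun t _ => (hu t).continuousAt.continuousWithinAt)
      (fun t _ => (hu t).hasDerivWithinAt) fun t ht => hu' t (interior_subset ht)
  have A : MonotoneOn (fun t => φ' t - m * t) (Set.Icc 0 1) :=
    mono (fun t => ((h2 t).fun_sub ((hasDerivAt_id t).const_mul m)))
      fun t ht => by simpa using hm t ht
  have A' : ∀ t ∈ Set.Icc (0 : ℝ) 1, m * t ≤ φ' t := fun t ht => by
    have := A m0 ht ht.1
    simp only [h0, mul_zero, sub_zero] at this
    linarith
  have B : MonotoneOn φ' (Set.Icc 0 1) := mono h2 fun t ht => hm0.trans (hm t ht)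
  have C : MonotoneOn (fun t => φ t - m / 2 * t ^ 2) (Set.Icc 0 1) :=
    mono (fun t => (h1 t).fun_sub ((hasDerivAt_pow 2 t).const_mul (m / 2)))
      fun t ht => by
        have := A' t ht
        simp
        linarith
  -- Since φ' is increasing, its value at 1 bounds the mean slope of φ from above.
  have D : MonotoneOn (fun t => φ' 1 * t - φ t) (Set.Icc 0 1) :=
    mono (fun t => ((hasDerivAt_id t).const_mul (φ' 1)).fun_sub (h1 t))
      fun t ht => by simpa using B ht m1 ht.2
  have hC := C m0 m1 zero_le_one
  have hD := D m0 m1 zero_le_one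
  have hA := A' 1 m1
  simp only [] at hC hD
  refine ⟨?_, ?_, ?_⟩ <;> linarith

/-- Uniform definiteness on a compact set. -/
lemma exists_forall_mul_sq_le {X ι : Type*} [TopologicalSpace X] [Fintype ι]
    {A : X → Matrix ι ι ℝ} (hA : Continuous A)
    (hpos : ∀ r h, ∑ i, h i = 0 → h ≠ 0 → 0 < h ⬝ᵥ (A r).mulVec h) {K : Set X}
    (hK : IsCompact K) :
    ∃ μ : ℝ, 0 < μ ∧ ∀ r ∈ K, ∀ h, ∑ i, h i = 0 → μ * ‖h‖ ^ 2 ≤ h ⬝ᵥ (A r).mulVec h := by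
  let S : Set (ι → ℝ) := Metric.sphere 0 1 ∩ {h | ∑ i, h i = 0}
  have hS : IsCompact S := (isCompact_sphere _ _).inter_right
    (isClosed_eq (by fun_prop) continuous_const)
  have hnorm : ∀ h : ι → ℝ, ∑ i, h i = 0 → h ≠ 0 → ‖h‖⁻¹ • h ∈ S := fun h hs h0 =>
    ⟨by simp [norm_smul, h0], by simp [← Finset.mul_sum, hs]⟩
  rcases (K ×ˢ S).eq_empty_or_nonempty with hemp | hne
  -- Either K is empty or there is no nonzero vector of sum zero, as when there is just one index;
  -- any constant works.
  · refine ⟨1, one_pos, fun r hr h hs => ?_⟩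
    by_cases h0 : h = 0
    · simp [h0]
    · have : (r, ‖h‖⁻¹ • h) ∈ K ×ˢ S := ⟨hr, hnorm h hs h0⟩
      simp [hemp] at this
  · have hcont : Continuous fun x : X × (ι → ℝ) => x.2 ⬝ᵥ (A x.1).mulVec x.2 := by
      have : ∀ i j, Continuous fun r => A r i j := fun i j =>
        (continuous_apply j).comp ((continuous_apply i).comp hA)
      simp only [dotProduct, Matrix.mulVec]
      fun_prop
    obtain ⟨x, hx, hmin⟩ := (hK.prod hS).exists_isMinOn hne hcont.continuousOn
    refine ⟨_, hpos x.1 x.2 hx.2.2 ?_, fun r hr h hs => ?_⟩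
    · rintro h0
      have := hx.2.1
      simp [h0] at this
    · by_cases h0 : h = 0
      · simp [h0]
      · have hn : 0 < ‖h‖ := norm_pos_iff.2 h0
        have h1 : x.2 ⬝ᵥ (A x.1).mulVec x.2 ≤ (‖h‖⁻¹ • h) ⬝ᵥ (A r).mulVec (‖h‖⁻¹ • h) :=
          hmin (show (r, ‖h‖⁻¹ • h) ∈ K ×ˢ S from ⟨hr, hnorm h hs h0⟩)
        rw [Matrix.mulVec_smul, smul_dotProduct, dotProduct_smul, smul_eq_mul, smul_eq_mul] at h1
        have h2 := mul_le_mul_of_nonneg_right h1 (sq_nonneg ‖h‖)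
        refine h2.trans_eq ?_
        field_simp

/-- Strong convexity of the potential near a critical point `rs`, on the hyperplane through it. -/
lemma exists_strong_convexity (hG : ∀ v : V, ∃ e : G.edgeSet, v ∈ e.1) (hconn : G.Connected)
    {κs rs : G.edgeSet → ℝ} (hrs : curvature G rs = κs) (R : ℝ) :
    ∃ μ : ℝ, 0 < μ ∧ ∀ r, ∑ i, r i = ∑ i, rs i → ‖r - rs‖ ≤ R →
      μ * ‖r - rs‖ ^ 2 ≤ potential G κs r - potential G κs rs ∧
      potential G κs r - potential G κs rs ≤ (curvature G r - κs) ⬝ᵥ (r - rs) ∧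
      μ * ‖r - rs‖ ^ 2 ≤ (curvature G r - κs) ⬝ᵥ (r - rs) := by
  obtain ⟨μ, hμ, hb⟩ := exists_forall_mul_sq_le (continuous_jacobian hG)
    (fun r h => dotProduct_jacobian_mulVec_pos hG hconn r) (isCompact_closedBall rs R)
  refine ⟨μ / 2, by positivity, fun r hs hR => ?_⟩
  set h := r - rs with hh
  have hsum : ∑ i, h i = 0 := by simp [hh, hs]
  have key := le_of_second_deriv_ge (hasDerivAt_potential_line hG κs rs h)
    (hasDerivAt_curvature_line hG κs rs h) (m := μ * ‖h‖ ^ 2) (by simp [hrs]) (by positivity) ?_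
  · have e : rs + (1 : ℝ) • h = r := by simp [hh]
    simp only [e, zero_smul, add_zero] at key
    have : 0 ≤ μ * ‖h‖ ^ 2 := by positivity
    refine ⟨?_, key.2.1, ?_⟩ <;> linarith [key.1, key.2.2]
  · intro t ht
    refine hb _ ?_ h hsum
    rw [mem_closedBall_iff_norm, add_sub_cancel_left, norm_smul, Real.norm_of_nonneg ht.1]
    exact (mul_le_of_le_one_left (norm_nonneg _) ht.2).trans hR

lemma convexOn_potential_line (hG : ∀ v : V, ∃ e : G.edgeSet, v ∈ e.1)
    (κs a h : G.edgeSet → ℝ) :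
    ConvexOn ℝ Set.univ fun t : ℝ => potential G κs (a + t • h) := by
  refine Monotone.convexOn_univ_of_deriv
    (fun t => (hasDerivAt_potential_line hG κs a h t).differentiableAt) ?_
  have : deriv (fun t : ℝ => potential G κs (a + t • h))
      = fun t => (curvature G (a + t • h) - κs) ⬝ᵥ h :=
    funext fun t => (hasDerivAt_potential_line hG κs a h t).deriv
  rw [this]
  exact monotone_of_hasDerivAt_nonneg (hasDerivAt_curvature_line hG κs a h)
    fun t => dotProduct_jacobian_mulVec_nonneg hG _ h

/-- If `κ*` is attained, the potential is proper on hyperplanes. -/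
lemma isCompact_sublevel_potential (hG : ∀ v : V, ∃ e : G.edgeSet, v ∈ e.1) (hconn : G.Connected)
    {κs rs r₀ : G.edgeSet → ℝ} (hrs : curvature G rs = κs) (hsum : ∑ i, rs i = ∑ i, r₀ i) :
    IsCompact (sublevel (potential G κs) r₀) := by
  obtain ⟨μ, hμ, hb⟩ := exists_strong_convexity hG hconn hrs 1
  refine (isCompact_closedBall rs
    (max 1 ((potential G κs r₀ - potential G κs rs) / μ))).of_isClosed_subset
    ((isClosed_eq (by fun_prop) continuous_const).inter
      (isClosed_le (continuous_potential hG κs) continuous_const)) fun r hr => ?_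
  rw [mem_closedBall_iff_norm]
  by_contra! hcon
  set ρ := ‖r - rs‖ with hρ
  have h1 : 1 < ρ := (le_max_left _ _).trans_lt hcon
  have h2 := (le_max_right _ _).trans_lt hcon
  have hρ0 : 0 < ρ := one_pos.trans h1
  rw [div_lt_iff₀ hμ] at h2
  -- At distance 1 from rs the potential has already risen by μ, so by convexity along the ray it
  -- rises by at least μ ρ at distance ρ.
  have hn : ‖rs + ρ⁻¹ • (r - rs) - rs‖ = 1 := by
    rw [add_sub_cancel_left, norm_smul, norm_inv, norm_norm, inv_mul_cancel₀ hρ0.ne']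
  have h3 := (hb (rs + ρ⁻¹ • (r - rs)) (by
    simp [Finset.sum_add_distrib, ← Finset.mul_sum, hr.1, hsum]) hn.le).1
  rw [hn] at h3
  have h4 := (convexOn_potential_line hG κs rs (r - rs)).2 (Set.mem_univ 0) (Set.mem_univ 1)
    (sub_nonneg.2 (inv_le_one_of_one_le₀ h1.le)) (inv_pos.2 hρ0).le (sub_add_cancel 1 ρ⁻¹)
  simp only [smul_eq_mul, mul_zero, mul_one, zero_add, zero_smul, add_zero, one_smul,
    add_sub_cancel] at h4
  have h5 : μ ≤ ρ⁻¹ * (potential G κs r - potential G κs rs) := by linarith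
  rw [inv_mul_eq_div, le_div_iff₀ hρ0] at h5
  linarith [hr.2]

end Calculus

/-! ### Powers of the Jacobian and the fractional Calabi flow -/

section Fractional

/-- For s ≤ 0 the function jumps at 0 on the real line, but 0 is an isolated point of this set. -/
lemma continuousOn_powZero (s : ℝ) {a b : ℝ} (ha : 0 < a) :
    ContinuousOn (powZero s) ({0} ∪ Set.Icc a b) := by
  refine (continuousOn_singleton _ _).union_of_isClosed ?_ isClosed_singleton isClosed_Icc
  refine ContinuousOn.congr (f := fun x : ℝ => x ^ s)
    (fun x hx => (Real.continuousAt_rpow_const x s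
      (Or.inl (ha.trans_le hx.1).ne')).continuousWithinAt)
    fun x hx => if_neg (ha.trans_le hx.1).ne'

lemma powZero_mul_powZero (s t : ℝ) {x : ℝ} (hx : 0 ≤ x) :
    powZero s x * powZero t x = powZero (s + t) x := by
  unfold powZero
  split_ifs with h
  · simp
  · rw [Real.rpow_add (hx.lt_of_ne' h)]

lemma powZero_one : powZero 1 = id := by
  ext x
  by_cases h : x = 0 <;> simp [powZero, h]

variable {V : Type*} [Fintype V] [DecidableEq V] {G : SimpleGraph V} [DecidableRel G.Adj]

lemma isSelfAdjoint_jacobian (hG : ∀ v : V, ∃ e : G.edgeSet, v ∈ e.1) (r : G.edgeSet → ℝ) :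
    IsSelfAdjoint (jacobian G r) := by
  ext i j
  simp [Matrix.star_apply, jacobian_isSymm hG r j i]

lemma exists_eigenvector_of_mem_spectrum {n : Type*} [Fintype n] [DecidableEq n]
    {A : Matrix n n ℝ} {x : ℝ} (hx : x ∈ spectrum ℝ A) : ∃ v, v ≠ 0 ∧ A.mulVec v = x • v := by
  rw [← Matrix.spectrum_toLin', ← Module.End.hasEigenvalue_iff_mem_spectrum] at hx
  obtain ⟨v, hv⟩ := hx.exists_hasEigenvector
  exact ⟨v, hv.2, by simpa using hv.apply_eq_smul⟩

lemma nonneg_of_mem_spectrum_jacobian (hG : ∀ v : V, ∃ e : G.edgeSet, v ∈ e.1)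
    {r : G.edgeSet → ℝ} {x : ℝ} (hx : x ∈ spectrum ℝ (jacobian G r)) : 0 ≤ x := by
  obtain ⟨v, hv, hvx⟩ := exists_eigenvector_of_mem_spectrum hx
  have h1 := dotProduct_jacobian_mulVec_nonneg hG r v
  rw [hvx, dotProduct_smul, smul_eq_mul] at h1
  exact nonneg_of_mul_nonneg_left h1 (by
    have : v ⬝ᵥ v ≠ 0 := fun h => hv (dotProduct_self_eq_zero.1 h)
    exact (Finset.sum_nonneg fun i _ => mul_self_nonneg (v i)).lt_of_ne' this)

lemma dotProduct_jacobian_comm (hG : ∀ v : V, ∃ e : G.edgeSet, v ∈ e.1)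
    (r u v : G.edgeSet → ℝ) :
    u ⬝ᵥ (jacobian G r).mulVec v = (jacobian G r).mulVec u ⬝ᵥ v := by
  have : (jacobian G r).transpose = jacobian G r := by
    ext i j
    exact jacobian_isSymm hG r j i
  rw [Matrix.dotProduct_mulVec, ← Matrix.mulVec_transpose, this]

lemma dotProduct_self_le {ι : Type*} [Fintype ι] (v : ι → ℝ) :
    v ⬝ᵥ v ≤ Fintype.card ι * ‖v‖ ^ 2 := by
  have : ∀ i ∈ Finset.univ, v i * v i ≤ ‖v‖ ^ 2 := fun i _ => by
    rw [← sq, ← sq_abs, ← Real.norm_eq_abs]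
    exact pow_le_pow_left₀ (norm_nonneg _) (norm_le_pi_norm v i) 2
  simpa [dotProduct] using Finset.sum_le_card_nsmul _ _ _ this

/-- Near `r`, the spectrum of the Jacobian lies in a fixed compact set with isolated point `0`. -/
lemma exists_spectrum_jacobian_subset (hG : ∀ v : V, ∃ e : G.edgeSet, v ∈ e.1)
    (hconn : G.Connected) (r₀ : G.edgeSet → ℝ) : ∃ a b : ℝ, 0 < a ∧
      ∀ᶠ r in 𝓝 r₀, spectrum ℝ (jacobian G r) ⊆ {0} ∪ Set.Icc a b := by
  obtain ⟨μ, hμ, hb⟩ := exists_forall_mul_sq_le (continuous_jacobian hG)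
    (fun r h => dotProduct_jacobian_mulVec_pos hG hconn r) (isCompact_closedBall r₀ 1)
  set n : ℝ := (Fintype.card G.edgeSet : ℝ) with hn
  have hn0 : 0 ≤ n := Nat.cast_nonneg _
  let f : (G.edgeSet → ℝ) → ℝ := fun r => ∑ i, ∑ j, |jacobian G r i j|
  have hf : Continuous f := by
    have : ∀ i j, Continuous fun r => jacobian G r i j := fun i j =>
      (continuous_apply j).comp ((continuous_apply i).comp (continuous_jacobian hG))
    fun_prop
  -- The factor n compares v · v with the squared sup norm in which `μ` is stated. The upper end
  -- bounds the operator norm by the sum of all entries, up to 1 for nearby r.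
  refine ⟨μ / (n + 1), f r₀ + 1, by positivity, ?_⟩
  filter_upwards [Metric.closedBall_mem_nhds r₀ one_pos,
    (hf.tendsto r₀).eventually (gt_mem_nhds (lt_add_one (f r₀)))] with r hr hfr x hx
  obtain ⟨v, hv, hvx⟩ := exists_eigenvector_of_mem_spectrum hx
  have hx0 := nonneg_of_mem_spectrum_jacobian hG hx
  by_cases h0 : x = 0
  · exact Or.inl h0
  have hvn : 0 < ‖v‖ := norm_pos_iff.2 hv
  refine Or.inr ⟨?_, ?_⟩
  -- An eigenvector with nonzero eigenvalue is orthogonal to the kernel vector 1, so the coercivity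
  -- bound applies to it.
  · have hs : ∑ i, v i = 0 := by
      have h1 := dotProduct_jacobian_comm hG r 1 v
      rw [hvx, jacobian_mulVec_one hG, zero_dotProduct, dotProduct_smul, smul_eq_mul,
        one_dotProduct] at h1
      exact (mul_eq_zero.1 h1).resolve_left h0
    have h2 := hb r hr v hs
    rw [hvx, dotProduct_smul, smul_eq_mul] at h2
    have h3 := mul_le_mul_of_nonneg_left (dotProduct_self_le v) hx0
    rw [← hn] at h3
    have h4 : μ * ‖v‖ ^ 2 ≤ x * n * ‖v‖ ^ 2 := by linarith
    have h5 := le_of_mul_le_mul_right h4 (by positivity)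
    rw [div_le_iff₀ (by positivity)]
    linarith
  · have h1 : ‖x • v‖ ≤ f r * ‖v‖ := by
      rw [← hvx]
      refine (pi_norm_le_iff_of_nonneg (mul_nonneg (Finset.sum_nonneg fun _ _ =>
        Finset.sum_nonneg fun _ _ => abs_nonneg _) hvn.le)).2 fun i => ?_
      calc ‖(jacobian G r).mulVec v i‖ ≤ ∑ j, ‖jacobian G r i j * v j‖ := norm_sum_le _ _
        _ ≤ ∑ j, |jacobian G r i j| * ‖v‖ := Finset.sum_le_sum fun j _ => by
            rw [norm_mul, Real.norm_eq_abs]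
            exact mul_le_mul_of_nonneg_left (norm_le_pi_norm v j) (abs_nonneg _)
        _ = (∑ j, |jacobian G r i j|) * ‖v‖ := (Finset.sum_mul _ _ _).symm
        _ ≤ f r * ‖v‖ := by
            refine mul_le_mul_of_nonneg_right ?_ hvn.le
            exact Finset.single_le_sum (f := fun i => ∑ j, |jacobian G r i j|)
              (fun i _ => Finset.sum_nonneg fun _ _ => abs_nonneg _) (Finset.mem_univ i)
    rw [norm_smul, Real.norm_of_nonneg hx0] at h1
    exact (le_of_mul_le_mul_right h1 hvn).trans hfr.le

-- The rank of J does not change with r, so nearby spectra stay in one compact set on which `powZero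
-- s` is continuous, and the functional calculus is continuous in r.
open scoped Matrix.Norms.L2Operator in
lemma continuous_jacobianPow (hG : ∀ v : V, ∃ e : G.edgeSet, v ∈ e.1) (hconn : G.Connected)
    (s : ℝ) : Continuous fun r => jacobianPow G r s := by
  choose a b ha hs using exists_spectrum_jacobian_subset hG hconn
  exact Continuous.cfc (s := fun r => {0} ∪ Set.Icc (a r) (b r)) (powZero s)
    (continuous_jacobian hG) (fun r => isCompact_singleton.union isCompact_Icc) hs
    (fun r => continuousOn_powZero s (ha r)) (isSelfAdjoint_jacobian hG)

lemma jacobianPow_mul (hG : ∀ v : V, ∃ e : G.edgeSet, v ∈ e.1) (r : G.edgeSet → ℝ) (s t : ℝ) :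
    jacobianPow G r s * jacobianPow G r t = jacobianPow G r (s + t) := by
  rw [jacobianPow, jacobianPow, ← cfc_mul _ _ _ (Matrix.finite_real_spectrum.continuousOn _)
    (Matrix.finite_real_spectrum.continuousOn _)]
  exact cfc_congr fun x hx => powZero_mul_powZero s t (nonneg_of_mem_spectrum_jacobian hG hx)

lemma jacobianPow_one (hG : ∀ v : V, ∃ e : G.edgeSet, v ∈ e.1) (r : G.edgeSet → ℝ) :
    jacobianPow G r 1 = jacobian G r := by
  rw [jacobianPow, powZero_one]
  exact cfc_id ℝ _ (isSelfAdjoint_jacobian hG r)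

lemma dotProduct_jacobianPow_comm (r u v : G.edgeSet → ℝ) (s : ℝ) :
    u ⬝ᵥ (jacobianPow G r s).mulVec v = (jacobianPow G r s).mulVec u ⬝ᵥ v := by
  have h : IsSelfAdjoint (jacobianPow G r s) := cfc_predicate _ _
  have : (jacobianPow G r s).transpose = jacobianPow G r s := by
    rw [← Matrix.conjTranspose_eq_transpose_of_trivial]
    exact h
  rw [Matrix.dotProduct_mulVec, ← Matrix.mulVec_transpose, this]

lemma jacobianPow_mulVec_one (hG : ∀ v : V, ∃ e : G.edgeSet, v ∈ e.1) (r : G.edgeSet → ℝ)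
    (s : ℝ) : (jacobianPow G r s).mulVec 1 = 0 := by
  rw [show s = (s - 1) + 1 by ring, ← jacobianPow_mul hG, ← Matrix.mulVec_mulVec,
    jacobianPow_one hG, jacobian_mulVec_one hG, Matrix.mulVec_zero]

lemma dotProduct_jacobianPow_eq (hG : ∀ v : V, ∃ e : G.edgeSet, v ∈ e.1) (r h : G.edgeSet → ℝ)
    (s : ℝ) : h ⬝ᵥ (jacobianPow G r s).mulVec h
      = (jacobianPow G r (s / 2)).mulVec h ⬝ᵥ (jacobianPow G r (s / 2)).mulVec h := by
  rw [← dotProduct_jacobianPow_comm, Matrix.mulVec_mulVec, jacobianPow_mul hG, add_halves]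

lemma dotProduct_jacobianPow_nonneg (hG : ∀ v : V, ∃ e : G.edgeSet, v ∈ e.1)
    (r h : G.edgeSet → ℝ) (s : ℝ) : 0 ≤ h ⬝ᵥ (jacobianPow G r s).mulVec h := by
  rw [dotProduct_jacobianPow_eq hG]
  exact Finset.sum_nonneg fun i _ => mul_self_nonneg _

/-- The form is |J^(s/2) h|². If it vanishes, so does J h = J^(1 - s/2) J^(s/2) h: with the
convention for 0 the exponents add for all real s, and J^s has the kernel of J. -/
lemma dotProduct_jacobianPow_pos (hG : ∀ v : V, ∃ e : G.edgeSet, v ∈ e.1)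
    (hconn : G.Connected) (s : ℝ) (r h : G.edgeSet → ℝ) (hs : ∑ i, h i = 0) (h0 : h ≠ 0) :
    0 < h ⬝ᵥ (jacobianPow G r s).mulVec h := by
  refine (dotProduct_jacobianPow_nonneg hG r h s).lt_of_ne' fun he => ?_
  rw [dotProduct_jacobianPow_eq hG, dotProduct_self_eq_zero] at he
  have hJ : (jacobian G r).mulVec h = 0 := by
    rw [← jacobianPow_one hG, show (1 : ℝ) = (1 - s / 2) + s / 2 by ring, ← jacobianPow_mul hG,
      ← Matrix.mulVec_mulVec, he, Matrix.mulVec_zero]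
  have := dotProduct_jacobian_mulVec_pos hG hconn r hs h0
  simp [hJ] at this

lemma sum_curvature_sub (hG : ∀ v : V, ∃ e : G.edgeSet, v ∈ e.1) {κs : G.edgeSet → ℝ}
    (hκs : ∑ e, κs e = 2 * ((Fintype.card V : ℝ) - (Fintype.card G.edgeSet : ℝ)))
    (r : G.edgeSet → ℝ) : ∑ i, (curvature G r - κs) i = 0 := by
  simp [Finset.sum_sub_distrib, sum_curvature hG, hκs]

lemma isLyapunov_fracCalabiField (hG : ∀ v : V, ∃ e : G.edgeSet, v ∈ e.1) (hconn : G.Connected)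
    (s : ℝ) (κs : G.edgeSet → ℝ) :
    IsLyapunov (potential G κs) (fun r => curvature G r - κs) (fracCalabiField G s κs) where
  grad := hasFDerivAt_potential hG κs
  cont := by
    have h1 := continuous_jacobianPow hG hconn s
    have h2 := continuous_curvature hG
    exact (h1.matrix_mulVec (h2.sub continuous_const)).neg
  sum_eq_zero r := by
    have := dotProduct_jacobianPow_comm r 1 (curvature G r - κs) s
    rw [jacobianPow_mulVec_one hG, zero_dotProduct, one_dotProduct] at this
    simp [fracCalabiField, fracLaplace, this]
  nonpos r := by
    have := dotProduct_jacobianPow_nonneg hG r (curvature G r - κs) s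
    rw [← neg_nonpos, ← dotProduct_neg] at this
    exact this

lemma dotProduct_le {ι : Type*} [Fintype ι] (u v : ι → ℝ) :
    u ⬝ᵥ v ≤ Fintype.card ι * (‖u‖ * ‖v‖) := by
  have : ∀ i ∈ Finset.univ, u i * v i ≤ ‖u‖ * ‖v‖ := fun i _ =>
    (le_abs_self _).trans (by
      rw [abs_mul]
      exact mul_le_mul (norm_le_pi_norm u i) (norm_le_pi_norm v i) (abs_nonneg _) (norm_nonneg _))
  simpa [dotProduct] using Finset.sum_le_card_nsmul _ _ _ this

/-- Strong convexity yields a Polyak–Łojasiewicz inequality: μ (Ψ - Ψ(rs)) ≤ n² ‖g‖², where g = κ -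
κ*. The dissipation is at least ν ‖g‖² by compactness, so it dominates Ψ - Ψ(rs). -/
theorem convergesExpTo_fracCalabiField (hG : ∀ v : V, ∃ e : G.edgeSet, v ∈ e.1)
    (hconn : G.Connected) {κs rs r₀ : G.edgeSet → ℝ}
    (hκs : ∑ e, κs e = 2 * ((Fintype.card V : ℝ) - (Fintype.card G.edgeSet : ℝ)))
    (hrs : curvature G rs = κs) (hsum : ∑ e, rs e = ∑ e, r₀ e) (s : ℝ) :
    ConvergesExpTo (fracCalabiField G s κs) r₀ rs := by
  have hK := isCompact_sublevel_potential hG hconn hrs hsum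
  obtain ⟨R, hR⟩ := hK.isBounded.subset_closedBall rs
  obtain ⟨μ, hμ, hconv⟩ := exists_strong_convexity hG hconn hrs R
  obtain ⟨ν, hν, hlow⟩ := exists_forall_mul_sq_le (continuous_jacobianPow hG hconn s)
    (dotProduct_jacobianPow_pos hG hconn s) hK
  set n : ℝ := (Fintype.card G.edgeSet : ℝ) with hn
  have hn0 : 0 ≤ n := Nat.cast_nonneg _
  have hball : ∀ r ∈ sublevel (potential G κs) r₀, ∑ i, r i = ∑ i, rs i ∧ ‖r - rs‖ ≤ R :=
    fun r hr => ⟨hr.1.trans hsum.symm, mem_closedBall_iff_norm.1 (hR hr)⟩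
  refine (isLyapunov_fracCalabiField hG hconn s κs).convergesExpTo hK
    (c := ν * μ / (n ^ 2 + 1)) (by positivity) hμ
    (fun r hr => (hconv r (hball r hr).1 (hball r hr).2).1) fun r hr => ?_
  obtain ⟨-, h1, h2⟩ := hconv r (hball r hr).1 (hball r hr).2
  have h3 := hlow r hr _ (sum_curvature_sub hG hκs r)
  have h4 := dotProduct_le (curvature G r - κs) (r - rs)
  set g := curvature G r - κs with hg
  set h := r - rs with hh
  have h5 : ∑ i, g i * fracCalabiField G s κs r i = -(g ⬝ᵥ (jacobianPow G r s).mulVec g) := by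
    rw [← dotProduct_neg]; rfl
  rw [h5, neg_mul, neg_le_neg_iff]
  refine le_trans ?_ h3
  have h6 : μ * ‖h‖ ≤ n * ‖g‖ := by
    rcases (norm_nonneg h).eq_or_lt with h0 | h0
    · rw [← h0, mul_zero]; positivity
    · refine le_of_mul_le_mul_right ?_ h0
      calc μ * ‖h‖ * ‖h‖ = μ * ‖h‖ ^ 2 := by ring
        _ ≤ n * (‖g‖ * ‖h‖) := h2.trans h4
        _ = n * ‖g‖ * ‖h‖ := by ring
  have h7 : μ * (potential G κs r - potential G κs rs) ≤ n ^ 2 * ‖g‖ ^ 2 :=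
    calc _ ≤ μ * (n * (‖g‖ * ‖h‖)) := mul_le_mul_of_nonneg_left (h1.trans h4) hμ.le
      _ = (n * ‖g‖) * (μ * ‖h‖) := by ring
      _ ≤ (n * ‖g‖) * (n * ‖g‖) := mul_le_mul_of_nonneg_left h6 (by positivity)
      _ = _ := by ring
  rw [div_mul_eq_mul_div, div_le_iff₀ (by positivity)]
  have h8 := mul_le_mul_of_nonneg_left h7 hν.le
  nlinarith [mul_nonneg hν.le (sq_nonneg ‖g‖)]

lemma fracCalabiField_one (hG : ∀ v : V, ∃ e : G.edgeSet, v ∈ e.1) (κs : G.edgeSet → ℝ) :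
    fracCalabiField G 1 κs = calabiField G κs := by
  ext r i
  simp [fracCalabiField, fracLaplace, calabiField, laplace, jacobianPow_one hG, Matrix.mulVec,
    dotProduct]

end Fractional

/-! ### The `p`-th Calabi flow -/

section PLaplace

/-- For p < 2 the power alone blows up at 0, but the product has absolute value |x|^(p - 1), with
positive exponent. -/
lemma continuous_abs_rpow_mul_self {p : ℝ} (hp : 1 < p) :
    Continuous fun x : ℝ => |x| ^ (p - 2) * x := by
  refine continuous_iff_continuousAt.2 fun x => ?_
  by_cases hx : x = 0
  · subst hx
    have h1 : Tendsto (fun x : ℝ => |x| ^ (p - 1)) (𝓝 0) (𝓝 0) := by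
      have h2 : Continuous fun x : ℝ => |x| ^ (p - 1) :=
        continuous_abs.rpow_const fun _ => Or.inr (by linarith)
      simpa [Real.zero_rpow (sub_pos.2 hp).ne'] using h2.tendsto 0
    rw [ContinuousAt, mul_zero]
    refine squeeze_zero_norm (fun x => ?_) h1
    by_cases hx : x = 0
    · simp [hx, Real.zero_rpow (sub_pos.2 hp).ne']
    · rw [norm_mul, Real.norm_eq_abs, Real.norm_eq_abs, abs_of_nonneg (by positivity),
        show p - 1 = (p - 2) + 1 by ring, Real.rpow_add_one (abs_ne_zero.2 hx)]
  · exact (continuousAt_id.abs.rpow_const (Or.inl (abs_ne_zero.2 hx))).mul continuousAt_id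

/-- Summation by parts. It turns the p-Laplacian into a Dirichlet energy and, with g = 1, shows that
its coordinates sum to zero. -/
lemma sum_mul_sum_of_antisymm {ι : Type*} [Fintype ι] {a : ι → ι → ℝ}
    (ha : ∀ i j, a j i = -a i j) (g : ι → ℝ) :
    ∑ i, g i * ∑ j, a i j = -(1 / 2) * ∑ i, ∑ j, (g j - g i) * a i j := by
  have h1 : ∑ i, ∑ j, g j * a i j = -∑ i, g i * ∑ j, a i j := by
    rw [Finset.sum_comm, ← Finset.sum_neg_distrib]
    refine Finset.sum_congr rfl fun i _ => ?_
    rw [Finset.mul_sum, ← Finset.sum_neg_distrib]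
    exact Finset.sum_congr rfl fun j _ => by rw [ha i j]; ring
  simp only [sub_mul, Finset.sum_sub_distrib, ← Finset.mul_sum]
  rw [h1]
  ring

variable {V : Type*} [Fintype V] [DecidableEq V] {G : SimpleGraph V} [DecidableRel G.Adj]

lemma neg_jacobian_eq (hG : ∀ v : V, ∃ e : G.edgeSet, v ∈ e.1) (r : G.edgeSet → ℝ)
    {i j : G.edgeSet} (hij : i ≠ j) :
    -jacobian G r i j = 2 * ∑ v, share G r v i * share G r v j := by
  simp [jacobian_apply hG, hij]

open Classical in
/-- The flow along the pair `i`, `j` of edges in the `p`-Laplacian of `g`. -/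
noncomputable def pTerm (G : SimpleGraph V) [DecidableRel G.Adj] (p : ℝ) (r g : G.edgeSet → ℝ)
    (i j : G.edgeSet) : ℝ :=
  if G.lineGraph.Adj i j then -jacobian G r i j * (|g j - g i| ^ (p - 2) * (g j - g i)) else 0

lemma pLaplace_eq (p : ℝ) (r g : G.edgeSet → ℝ) (i : G.edgeSet) :
    pLaplace G p r g i = ∑ j, pTerm G p r g i j := by
  simp only [pLaplace, pTerm, Finset.sum_filter, mul_assoc]

lemma pTerm_antisymm (hG : ∀ v : V, ∃ e : G.edgeSet, v ∈ e.1) (p : ℝ) (r g : G.edgeSet → ℝ)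
    (i j : G.edgeSet) : pTerm G p r g j i = -pTerm G p r g i j := by
  unfold pTerm
  rw [G.lineGraph.adj_comm j i, jacobian_isSymm hG r j i, abs_sub_comm (g i)]
  split_ifs <;> ring

lemma neg_jacobian_pos_of_adj (hG : ∀ v : V, ∃ e : G.edgeSet, v ∈ e.1) (r : G.edgeSet → ℝ)
    {i j : G.edgeSet} (h : G.lineGraph.Adj i j) : 0 < -jacobian G r i j := by
  obtain ⟨hne, v, hi, hj⟩ := SimpleGraph.lineGraph_adj_iff_exists.1 h
  rw [neg_jacobian_eq hG r hne]
  refine mul_pos two_pos (Finset.sum_pos' (fun v _ =>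
    mul_nonneg (share_nonneg r v i) (share_nonneg r v j))
    ⟨v, Finset.mem_univ v, mul_pos (share_pos r hi) (share_pos r hj)⟩)

lemma sub_mul_pTerm_nonneg (hG : ∀ v : V, ∃ e : G.edgeSet, v ∈ e.1) (p : ℝ)
    (r g : G.edgeSet → ℝ) (i j : G.edgeSet) : 0 ≤ (g j - g i) * pTerm G p r g i j := by
  unfold pTerm
  split_ifs with h
  · have h1 := (neg_jacobian_pos_of_adj hG r h).le
    have h2 : 0 ≤ |g j - g i| ^ (p - 2) := by positivity
    calc (0 : ℝ) ≤ -jacobian G r i j * |g j - g i| ^ (p - 2) * ((g j - g i) * (g j - g i)) :=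
          mul_nonneg (mul_nonneg h1 h2) (mul_self_nonneg _)
      _ = _ := by ring
  · rw [mul_zero]

lemma sum_mul_pLaplace (hG : ∀ v : V, ∃ e : G.edgeSet, v ∈ e.1) (p : ℝ)
    (r g : G.edgeSet → ℝ) : ∑ i, g i * pLaplace G p r g i
      = -(1 / 2) * ∑ i, ∑ j, (g j - g i) * pTerm G p r g i j := by
  simp only [pLaplace_eq]
  exact sum_mul_sum_of_antisymm (pTerm_antisymm hG p r g) g

lemma sum_mul_pLaplace_nonpos (hG : ∀ v : V, ∃ e : G.edgeSet, v ∈ e.1) (p : ℝ)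
    (r g : G.edgeSet → ℝ) : ∑ i, g i * pLaplace G p r g i ≤ 0 := by
  rw [sum_mul_pLaplace hG]
  have := Finset.sum_nonneg fun i (_ : i ∈ Finset.univ) =>
    Finset.sum_nonneg fun j (_ : j ∈ Finset.univ) => sub_mul_pTerm_nonneg hG p r g i j
  linarith

/-- Zero energy would make g equal on adjacent edges, hence constant by connectedness, hence zero.
-/
lemma sum_mul_pLaplace_neg (hG : ∀ v : V, ∃ e : G.edgeSet, v ∈ e.1) (hconn : G.Connected)
    (p : ℝ) (r : G.edgeSet → ℝ) {g : G.edgeSet → ℝ} (hs : ∑ i, g i = 0) (h0 : g ≠ 0) :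
    ∑ i, g i * pLaplace G p r g i < 0 := by
  refine (sum_mul_pLaplace_nonpos hG p r g).lt_of_ne fun he => h0 ?_
  refine eq_zero_of_sum_eq_zero (eq_of_forall_mem_eq hconn fun e f v hve hvf => ?_) hs
  by_contra hne
  rw [sum_mul_pLaplace hG] at he
  have hn := sub_mul_pTerm_nonneg hG p r g
  have h1 := (mul_eq_zero.1 he).resolve_left (by norm_num)
  have h2 := (Finset.sum_eq_zero_iff_of_nonneg fun i _ =>
    Finset.sum_nonneg fun j _ => hn i j).1 h1 e (Finset.mem_univ _)
  have h3 := (Finset.sum_eq_zero_iff_of_nonneg fun j _ => hn e j).1 h2 f (Finset.mem_univ _)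
  have hadj : G.lineGraph.Adj e f :=
    SimpleGraph.lineGraph_adj_iff_exists.2 ⟨fun h => hne (by rw [h]), v, hve, hvf⟩
  have hsub : g f - g e ≠ 0 := sub_ne_zero.2 (Ne.symm hne)
  rw [pTerm, if_pos hadj] at h3
  have h4 := (neg_jacobian_pos_of_adj hG r hadj).ne'
  have h5 : |g f - g e| ^ (p - 2) ≠ 0 := (Real.rpow_pos_of_pos (abs_pos.2 hsub) _).ne'
  exact mul_ne_zero hsub (mul_ne_zero h4 (mul_ne_zero h5 hsub)) h3

lemma isLyapunov_pCalabiField (hG : ∀ v : V, ∃ e : G.edgeSet, v ∈ e.1) {p : ℝ} (hp : 1 < p)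
    (κs : G.edgeSet → ℝ) :
    IsLyapunov (potential G κs) (fun r => curvature G r - κs) (pCalabiField G p κs) where
  grad := hasFDerivAt_potential hG κs
  cont := by
    refine continuous_pi fun i => ?_
    simp only [pCalabiField, pLaplace_eq, pTerm]
    refine continuous_finsetSum _ fun j _ => ?_
    split_ifs
    · have h1 : Continuous fun r => jacobian G r i j :=
        (continuous_apply j).comp ((continuous_apply i).comp (continuous_jacobian hG))
      have h2 : ∀ i, Continuous fun r => (curvature G r - κs) i := fun i =>
        ((continuous_apply i).comp (continuous_curvature hG)).sub continuous_const
      exact h1.neg.mul ((continuous_abs_rpow_mul_self hp).comp ((h2 j).sub (h2 i)))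
    · exact continuous_const
  sum_eq_zero r := by
    have := sum_mul_sum_of_antisymm (pTerm_antisymm hG p r (curvature G r - κs)) 1
    simpa [pCalabiField, pLaplace_eq] using this
  nonpos r := sum_mul_pLaplace_nonpos hG p r _

theorem convergesTo_pCalabiField (hG : ∀ v : V, ∃ e : G.edgeSet, v ∈ e.1)
    (hconn : G.Connected) {κs rs r₀ : G.edgeSet → ℝ}
    (hκs : ∑ e, κs e = 2 * ((Fintype.card V : ℝ) - (Fintype.card G.edgeSet : ℝ)))
    (hrs : curvature G rs = κs) (hsum : ∑ e, rs e = ∑ e, r₀ e) {p : ℝ} (hp : 1 < p) :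
    ConvergesTo (pCalabiField G p κs) r₀ rs := by
  have hK := isCompact_sublevel_potential hG hconn hrs hsum
  obtain ⟨R, hR⟩ := hK.isBounded.subset_closedBall rs
  obtain ⟨μ, hμ, hconv⟩ := exists_strong_convexity hG hconn hrs R
  have hpos : ∀ r ∈ sublevel (potential G κs) r₀, r ≠ rs →
      potential G κs rs < potential G κs r ∧ curvature G r - κs ≠ 0 := by
    intro r hr hne
    obtain ⟨h1, -, h3⟩ := hconv r (hr.1.trans hsum.symm) (mem_closedBall_iff_norm.1 (hR hr))
    have h4 : 0 < ‖r - rs‖ := norm_pos_iff.2 (sub_ne_zero.2 hne)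
    have h5 : 0 < μ * ‖r - rs‖ ^ 2 := by positivity
    refine ⟨by linarith, fun h0 => ?_⟩
    rw [h0, zero_dotProduct] at h3
    linarith
  exact (isLyapunov_pCalabiField hG hp κs).convergesTo
    ((continuous_curvature hG).sub continuous_const) hK (fun r hr hne => (hpos r hr hne).1)
    fun r hr hne => sum_mul_pLaplace_neg hG hconn p r (sum_curvature_sub hG hκs r)
      (hpos r hr hne).2

/-- The rows of J sum to zero, so -J g is a sum of differences of g; entries of J at distinct edges
without a common endpoint vanish. -/
lemma pCalabiField_two (hG : ∀ v : V, ∃ e : G.edgeSet, v ∈ e.1) (κs : G.edgeSet → ℝ) :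
    pCalabiField G 2 κs = calabiField G κs := by
  ext r i
  simp only [pCalabiField, calabiField, pLaplace_eq, laplace, pTerm]
  set g := curvature G r - κs
  have h1 : ∑ j, jacobian G r i j = 0 := by
    simpa [Matrix.mulVec, dotProduct] using congrFun (jacobian_mulVec_one hG r) i
  have h2 : -∑ j, jacobian G r i j * g j = ∑ j, -jacobian G r i j * (g j - g i) := by
    simp only [mul_sub, neg_mul, Finset.sum_sub_distrib, Finset.sum_neg_distrib,
      ← Finset.sum_mul, h1]
    ring
  rw [h2]
  refine Finset.sum_congr rfl fun j _ => ?_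
  split_ifs with h
  · simp
  · by_cases hij : i = j
    · simp [hij]
    · have hv : ∀ v, share G r v i * share G r v j = 0 := by
        intro v
        by_contra hne
        obtain ⟨hi, hj⟩ := mul_ne_zero_iff.1 hne
        refine h (SimpleGraph.lineGraph_adj_iff_exists.2 ⟨hij, v, ?_, ?_⟩)
        · by_contra hv
          exact hi (if_neg hv)
        · by_contra hv
          exact hj (if_neg hv)
      rw [neg_jacobian_eq hG r hij]
      simp [hv]

end PLaplace

/-! ### Limits of the flows -/

section Limits

variable {V : Type*} [Fintype V] [DecidableEq V] {G : SimpleGraph V} [DecidableRel G.Adj]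

theorem curvature_eq_of_convergesTo_calabiField (hG : ∀ v : V, ∃ e : G.edgeSet, v ∈ e.1)
    (hconn : G.Connected) {κs rs r₀ : G.edgeSet → ℝ}
    (hκs : ∑ e, κs e = 2 * ((Fintype.card V : ℝ) - (Fintype.card G.edgeSet : ℝ)))
    (h : ConvergesTo (calabiField G κs) r₀ rs) : curvature G rs = κs := by
  rw [← fracCalabiField_one hG] at h
  have h0 := h.eq_zero (isLyapunov_fracCalabiField hG hconn 1 κs).cont
  rw [fracCalabiField, fracLaplace, neg_eq_zero] at h0
  by_contra hne
  have := dotProduct_jacobianPow_pos hG hconn 1 rs _ (sum_curvature_sub hG hκs rs)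
    (sub_ne_zero.2 hne)
  simp [h0] at this

/-- Shares are invariant under scaling all weights by exp c; this freedom allows the normalization
of the coordinate sum. -/
lemma curvature_add_const (r : G.edgeSet → ℝ) (c : ℝ) :
    curvature G (fun e => r e + c) = curvature G r := by
  have hw : ∀ e, weight G (fun e => r e + c) e = Real.exp c * weight G r e := fun e => by
    rw [weight, weight, Real.exp_add, mul_comm]
  have hm : ∀ v, vertexWeight G (fun e => r e + c) v = Real.exp c * vertexWeight G r v :=
    fun v => by simp only [vertexWeight, hw, Finset.mul_sum]
  ext e
  simp only [curvature_eq, share, hw, hm, mul_div_mul_left _ _ (Real.exp_pos c).ne']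

/-- A weight with prescribed curvature can be normalized. -/
lemma exists_normalized [Nonempty G.edgeSet] {κs rs : G.edgeSet → ℝ} (hrs : curvature G rs = κs)
    (r₀ : G.edgeSet → ℝ) : ∃ rs, curvature G rs = κs ∧ ∑ e, rs e = ∑ e, r₀ e := by
  refine ⟨fun e => rs e + (∑ e, r₀ e - ∑ e, rs e) / Fintype.card G.edgeSet,
    by rw [curvature_add_const, hrs], ?_⟩
  have : (Fintype.card G.edgeSet : ℝ) ≠ 0 := Nat.cast_ne_zero.2 Fintype.card_ne_zero
  rw [Finset.sum_add_distrib, Finset.sum_const, Finset.card_univ, nsmul_eq_mul,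
    mul_div_cancel₀ _ this, add_sub_cancel]

end Limits

/-! ### The Lin-Lu-Yau curvature -/

section Transport

variable {V : Type*} [Fintype V] {G : SimpleGraph V} {μ ν : V → ℝ}

lemma IsCoupling.sum_mul_sub {ρ : V → V → ℝ} (h : IsCoupling μ ν ρ) (f : V → ℝ) :
    ∑ u, ∑ v, ρ u v * (f u - f v) = ∑ u, f u * μ u - ∑ v, f v * ν v := by
  simp only [mul_sub, Finset.sum_sub_distrib]
  congr 1
  · exact Finset.sum_congr rfl fun u _ => by rw [← Finset.sum_mul, h.fst, mul_comm]
  · rw [Finset.sum_comm]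
    exact Finset.sum_congr rfl fun v _ => by rw [← Finset.sum_mul, h.snd, mul_comm]

lemma IsCoupling.eq_zero_of_fst {ρ : V → V → ℝ} (h : IsCoupling μ ν ρ) {u : V} (hu : μ u = 0)
    (v : V) : ρ u v = 0 :=
  (Finset.sum_eq_zero_iff_of_nonneg fun v _ => (h.mem_Icc u v).1).1 ((h.fst u).trans hu) v
    (Finset.mem_univ v)

lemma IsCoupling.eq_zero_of_snd {ρ : V → V → ℝ} (h : IsCoupling μ ν ρ) {v : V} (hv : ν v = 0)
    (u : V) : ρ u v = 0 :=
  (Finset.sum_eq_zero_iff_of_nonneg fun u _ => (h.mem_Icc u v).1).1 ((h.snd v).trans hv) u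
    (Finset.mem_univ u)

/-- Kantorovich duality for a transport plan that keeps the smaller masses at `x` and `y` in place
and sends the rest along pairs on which the potential `f` is tight. -/
lemma wasserstein_eq_of_tight {x y : V} (hxy : x ≠ y)
    (hμ : ∀ u, 0 ≤ μ u) (hν : ∀ v, 0 ≤ ν v) (hμ1 : ∑ u, μ u = 1) (hν1 : ∑ v, ν v = 1)
    (hx : ν x ≤ μ x) (hy : μ y ≤ ν y) (hM : ν x + μ y < 1) (f : V → ℝ)
    (hlow : ∀ u v, μ u ≠ 0 → ν v ≠ 0 → f u - f v ≤ G.dist u v)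
    (hup : ∀ u v, μ u ≠ 0 → ν v ≠ 0 → u ≠ y → v ≠ x → (G.dist u v : ℝ) ≤ f u - f v) :
    wasserstein G μ ν = ∑ u, f u * μ u - ∑ v, f v * ν v := by
  classical
  let δ : V → ℝ := fun u => (if u = x then ν x else 0) + (if u = y then μ y else 0)
  have hδx : δ x = ν x := by simp [δ, hxy]
  have hδy : δ y = μ y := by simp [δ, hxy.symm]
  have hδ0 : ∀ u, u ≠ x → u ≠ y → δ u = 0 := fun u h1 h2 => by simp [δ, h1, h2]
  have hδμ : ∀ u, δ u ≤ μ u := fun u => by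
    by_cases h1 : u = x
    · rw [h1, hδx]; exact hx
    by_cases h2 : u = y
    · rw [h2, hδy]
    rw [hδ0 u h1 h2]; exact hμ u
  have hδν : ∀ u, δ u ≤ ν u := fun u => by
    by_cases h1 : u = x
    · rw [h1, hδx]
    by_cases h2 : u = y
    · rw [h2, hδy]; exact hy
    rw [hδ0 u h1 h2]; exact hν u
  have hδn : ∀ u, 0 ≤ δ u := fun u =>
    add_nonneg (by split_ifs <;> simp [hν]) (by split_ifs <;> simp [hμ])
  have hδs : ∑ u, δ u = ν x + μ y := by simp [δ, Finset.sum_add_distrib]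
  set M := 1 - (ν x + μ y) with hMdef
  have hM0 : 0 < M := sub_pos.2 hM
  have hMμ : ∑ u, (μ u - δ u) = M := by rw [Finset.sum_sub_distrib, hμ1, hδs]
  have hMν : ∑ u, (ν u - δ u) = M := by rw [Finset.sum_sub_distrib, hν1, hδs]
  -- The mass δ stays put and the two excesses, both of total M, are coupled independently. Neither
  -- y as a source nor x as a target has excess.
  let ρ : V → V → ℝ := fun u v => (if u = v then δ u else 0) + (μ u - δ u) * (ν v - δ v) / M
  have hρn : ∀ u v, 0 ≤ ρ u v := fun u v => by
    refine add_nonneg (by split_ifs <;> simp [hδn]) (div_nonneg ?_ hM0.le)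
    exact mul_nonneg (sub_nonneg.2 (hδμ u)) (sub_nonneg.2 (hδν v))
  have hfst : ∀ u, ∑ v, ρ u v = μ u := fun u => by
    simp only [ρ, Finset.sum_add_distrib, ← Finset.sum_div, ← Finset.mul_sum, hMν]
    rw [mul_div_cancel_right₀ _ hM0.ne']
    simp
  have hsnd : ∀ v, ∑ u, ρ u v = ν v := fun v => by
    simp only [ρ, Finset.sum_add_distrib, ← Finset.sum_div, ← Finset.sum_mul, hMμ]
    rw [mul_div_cancel_left₀ _ hM0.ne']
    simp
  have hρ : IsCoupling μ ν ρ := by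
    refine ⟨fun u v => ⟨hρn u v, ?_⟩, hfst, hsnd⟩
    calc ρ u v ≤ ∑ v, ρ u v :=
          Finset.single_le_sum (fun v _ => hρn u v) (Finset.mem_univ v)
      _ = μ u := hfst u
      _ ≤ ∑ u, μ u := Finset.single_le_sum (fun u _ => hμ u) (Finset.mem_univ u)
      _ = 1 := hμ1
  have hcost : ∑ u, ∑ v, ρ u v * (G.dist u v : ℝ) = ∑ u, f u * μ u - ∑ v, f v * ν v := by
    rw [← hρ.sum_mul_sub f]
    refine Finset.sum_congr rfl fun u _ => Finset.sum_congr rfl fun v _ => ?_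
    by_cases huv : u = v
    · simp [huv]
    by_cases hμu : μ u = 0
    · simp [hρ.eq_zero_of_fst hμu v]
    by_cases hνv : ν v = 0
    · simp [hρ.eq_zero_of_snd hνv u]
    by_cases huy : u = y
    · have : ρ u v = 0 := by
        subst huy
        simp [ρ, huv, hδy]
      simp [this]
    by_cases hvx : v = x
    · have : ρ u v = 0 := by
        subst hvx
        simp [ρ, huv, hδx]
      simp [this]
    rw [le_antisymm (hup u v hμu hνv huy hvx) (hlow u v hμu hνv)]
  have hleast : IsLeast {c | ∃ ρ : V → V → ℝ, IsCoupling μ ν ρ ∧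
      c = ∑ x, ∑ y, ρ x y * (G.dist x y : ℝ)} (∑ u, f u * μ u - ∑ v, f v * ν v) := by
    refine ⟨⟨ρ, hρ, hcost.symm⟩, ?_⟩
    rintro c ⟨π, hπ, rfl⟩
    rw [← hπ.sum_mul_sub f]
    refine Finset.sum_le_sum fun u _ => Finset.sum_le_sum fun v _ => ?_
    by_cases hμu : μ u = 0
    · simp [hπ.eq_zero_of_fst hμu v]
    by_cases hνv : ν v = 0
    · simp [hπ.eq_zero_of_snd hνv u]
    exact mul_le_mul_of_nonneg_left (hlow u v hμu hνv) (hπ.mem_Icc u v).1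
  exact hleast.csInf_eq

end Transport

/-! ### Short cycles and distances in girth at least 6. -/

section Girth

variable {V : Type*} {G : SimpleGraph V}

lemma not_triangle_of_egirth (hg : 6 ≤ G.egirth) {a b c : V} (hab : G.Adj a b) (hbc : G.Adj b c)
    (hca : G.Adj c a) : False := by
  have hcyc : (SimpleGraph.Walk.cons hab (.cons hbc (.cons hca .nil))).IsCycle := by
    have := hab.ne
    have := hbc.ne
    have := hca.ne
    simp [SimpleGraph.Walk.isCycle_def, SimpleGraph.Walk.isTrail_def]
    grind
  have := SimpleGraph.le_egirth.1 hg _ _ hcyc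
  simp at this
  exact absurd this (by decide)

lemma not_square_of_egirth (hg : 6 ≤ G.egirth) {a b c d : V} (hab : G.Adj a b) (hbc : G.Adj b c)
    (hcd : G.Adj c d) (hda : G.Adj d a) (hac : a ≠ c) (hbd : b ≠ d) : False := by
  have hcyc : (SimpleGraph.Walk.cons hab (.cons hbc (.cons hcd (.cons hda .nil)))).IsCycle := by
    have := hab.ne
    have := hbc.ne
    have := hcd.ne
    have := hda.ne
    simp [SimpleGraph.Walk.isCycle_def, SimpleGraph.Walk.isTrail_def]
    grind
  have := SimpleGraph.le_egirth.1 hg _ _ hcyc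
  simp at this
  exact absurd this (by decide)

lemma not_pentagon_of_egirth (hg : 6 ≤ G.egirth) {a b c d e : V} (hab : G.Adj a b)
    (hbc : G.Adj b c) (hcd : G.Adj c d) (hde : G.Adj d e) (hea : G.Adj e a) (hac : a ≠ c)
    (hbd : b ≠ d) (hce : c ≠ e) (hda : d ≠ a) (heb : e ≠ b) : False := by
  have hcyc : (SimpleGraph.Walk.cons hab (.cons hbc (.cons hcd (.cons hde
      (.cons hea .nil))))).IsCycle := by
    have := hab.ne
    have := hbc.ne
    have := hcd.ne
    have := hde.ne
    have := hea.ne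
    simp [SimpleGraph.Walk.isCycle_def, SimpleGraph.Walk.isTrail_def]
    grind
  have := SimpleGraph.le_egirth.1 hg _ _ hcyc
  simp at this
  exact absurd this (by decide)

lemma two_le_dist (hconn : G.Connected) {u v : V} (hne : u ≠ v) (hadj : ¬ G.Adj u v) :
    2 ≤ G.dist u v := by
  have h0 := hconn.pos_dist_of_ne hne
  have h1 : G.dist u v ≠ 1 := fun h => hadj (SimpleGraph.dist_eq_one_iff_adj.1 h)
  omega

/-- In girth at least `6`, a path `x', x, y, y'` is a geodesic. -/
lemma three_le_dist (hconn : G.Connected) (hg : 6 ≤ G.egirth) {x y x' y' : V} (hxy : G.Adj x y)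
    (hx : G.Adj x x') (hy : G.Adj y y') (hx' : x' ≠ y) (hy' : y' ≠ x) :
    3 ≤ G.dist x' y' := by
  by_contra! hlt
  obtain ⟨p, hp⟩ := hconn.exists_walk_length_eq_dist x' y'
  rw [← hp] at hlt
  -- A connection of length 0, 1 or 2 closes the path to a triangle, a square or a pentagon, up to
  -- degenerate cases that contain a triangle.
  rcases p with _ | ⟨h1, _ | ⟨h2, _ | ⟨h3, q⟩⟩⟩
  · exact not_triangle_of_egirth hg hxy hy hx.symm
  · exact not_square_of_egirth hg hxy hy h1.symm hx.symm hy'.symm hx'.symm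
  · rename_i w
    have hwx : w ≠ x := by
      rintro rfl
      exact not_triangle_of_egirth hg hxy hy h2.symm
    have hwy : w ≠ y := by
      rintro rfl
      exact not_triangle_of_egirth hg hxy h1.symm hx.symm
    have hne : y' ≠ x' := by
      rintro rfl
      exact not_triangle_of_egirth hg hxy hy hx.symm
    exact not_pentagon_of_egirth hg hxy hy h2.symm h1.symm hx.symm hy'.symm hwy.symm hne hwx hx'
  · simp only [SimpleGraph.Walk.length_cons] at hlt
    omega

/-- Source of the standing assumption `hG`, which makes m(v) positive at every vertex. -/
lemma exists_mem_edge (hconn : G.Connected) (e₀ : G.edgeSet) (v : V) :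
    ∃ e : G.edgeSet, v ∈ e.1 := by
  obtain ⟨⟨a, b⟩, hab⟩ := e₀
  have : Nontrivial V := ⟨a, b, hab.ne⟩
  obtain ⟨w, hw⟩ := hconn.preconnected.exists_adj_of_nontrivial v
  exact ⟨⟨s(v, w), hw⟩, Sym2.mem_mk_left v w⟩

end Girth

/-! ### Transport between the walk measures of adjacent vertices. -/

section LinLuYau

variable {V : Type*} [Fintype V] [DecidableEq V] {G : SimpleGraph V} [DecidableRel G.Adj]

lemma sum_weight_neighbors (r : G.edgeSet → ℝ) (x : V) :
    ∑ z, (if h : G.Adj x z then weight G r ⟨s(x, z), h⟩ else 0) = vertexWeight G r x := by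
  have h1 : ∀ z, (if h : G.Adj x z then weight G r ⟨s(x, z), h⟩ else 0)
      = ∑ e : G.edgeSet, if e.1 = s(x, z) then weight G r e else 0 := by
    intro z
    split_ifs with h
    · rw [Finset.sum_eq_single ⟨s(x, z), h⟩ (fun e _ he => if_neg fun h' => he (Subtype.ext h'))
        (fun h' => absurd (Finset.mem_univ _) h'), if_pos rfl]
    · refine (Finset.sum_eq_zero fun e _ => if_neg fun he => h ?_).symm
      have := e.2
      rwa [he] at this
  simp only [h1]
  rw [Finset.sum_comm, vertexWeight, Finset.sum_filter]
  refine Finset.sum_congr rfl fun e _ => ?_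
  split_ifs with hx
  · obtain ⟨w, hw⟩ := Sym2.mem_iff_exists.1 hx
    simp only [hw, Sym2.congr_right]
    simp
  · refine Finset.sum_eq_zero fun z _ => if_neg fun he : e.1 = s(x, z) => hx ?_
    rw [he]
    exact Sym2.mem_mk_left x z

lemma walkMeasure_self (r : G.edgeSet → ℝ) (α : ℝ) (x : V) : walkMeasure G r α x x = α :=
  if_pos rfl

lemma walkMeasure_of_adj (r : G.edgeSet → ℝ) (α : ℝ) {x z : V} (h : G.Adj x z) :
    walkMeasure G r α x z = (1 - α) * share G r x ⟨s(x, z), h⟩ := by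
  rw [walkMeasure, if_neg h.ne', dif_pos h, share, if_pos (Sym2.mem_mk_left x z), mul_div_assoc]

lemma eq_or_adj_of_walkMeasure_ne_zero {r : G.edgeSet → ℝ} {α : ℝ} {x z : V}
    (h : walkMeasure G r α x z ≠ 0) : z = x ∨ G.Adj x z := by
  by_contra! hz
  exact h (by rw [walkMeasure, if_neg hz.1, dif_neg hz.2])

lemma walkMeasure_nonneg (r : G.edgeSet → ℝ) {α : ℝ} (h0 : 0 ≤ α) (h1 : α ≤ 1) (x z : V) :
    0 ≤ walkMeasure G r α x z := by
  by_cases h : z = x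
  · rw [h, walkMeasure_self]; exact h0
  by_cases hz : G.Adj x z
  · rw [walkMeasure_of_adj r α hz]
    exact mul_nonneg (sub_nonneg.2 h1) (share_nonneg _ _ _)
  · rw [walkMeasure, if_neg h, dif_neg hz]

lemma sum_walkMeasure (hG : ∀ v : V, ∃ e : G.edgeSet, v ∈ e.1) (r : G.edgeSet → ℝ) (α : ℝ)
    (x : V) : ∑ z, walkMeasure G r α x z = 1 := by
  obtain ⟨e, he⟩ := hG x
  have h1 : ∀ z, walkMeasure G r α x z = (if z = x then α else 0)
      + (1 - α) / vertexWeight G r x *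
        (if h : G.Adj x z then weight G r ⟨s(x, z), h⟩ else 0) := by
    intro z
    unfold walkMeasure
    split_ifs with h h'
    · subst h; exact absurd h' (G.loopless.irrefl z)
    · simp
    · ring
    · simp
  simp only [h1, Finset.sum_add_distrib, ← Finset.mul_sum, sum_weight_neighbors,
    div_mul_cancel₀ _ (vertexWeight_pos r he).ne']
  simp

lemma share_le_one (hG : ∀ v : V, ∃ e : G.edgeSet, v ∈ e.1) (r : G.edgeSet → ℝ) (v : V)
    (i : G.edgeSet) : share G r v i ≤ 1 :=
  (Finset.single_le_sum (fun i _ => share_nonneg r v i) (Finset.mem_univ i)).trans_eq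
    (sum_share hG r v)

lemma curvature_mk (r : G.edgeSet → ℝ) {x y : V} (h : G.Adj x y) :
    curvature G r ⟨s(x, y), h⟩
      = 2 * (share G r x ⟨s(x, y), h⟩ + share G r y ⟨s(x, y), h⟩) - 2 := by
  have h0 : ∀ v ∈ Finset.univ, v ≠ x ∧ v ≠ y → share G r v ⟨s(x, y), h⟩ = 0 :=
    fun v _ hv => if_neg (by simpa using hv)
  rw [curvature_eq, Finset.sum_eq_add x y h.ne h0
    (fun h' => absurd (Finset.mem_univ _) h') (fun h' => absurd (Finset.mem_univ _) h')]

/-- For α > 1/2 the masses at x and y dominate, and all excess can flow along geodesics through the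
edge xy. -/
lemma wasserstein_walkMeasure (hG : ∀ v : V, ∃ e : G.edgeSet, v ∈ e.1) (hconn : G.Connected)
    (hg : 6 ≤ G.egirth) (r : G.edgeSet → ℝ) {x y : V} (h : G.Adj x y) {α : ℝ}
    (hα : α ∈ Set.Ioo (1 / 2 : ℝ) 1) :
    wasserstein G (walkMeasure G r α x) (walkMeasure G r α y)
      = 1 - (1 - α) * curvature G r ⟨s(x, y), h⟩ := by
  obtain ⟨hα0, hα1⟩ := hα
  have hμy := walkMeasure_of_adj r α h
  have hνx : walkMeasure G r α y x = (1 - α) * share G r y ⟨s(x, y), h⟩ := by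
    rw [walkMeasure_of_adj r α h.symm]
    congr 2
    exact Subtype.ext Sym2.eq_swap
  have ha := share_le_one hG r x ⟨s(x, y), h⟩
  have hb := share_le_one hG r y ⟨s(x, y), h⟩
  have hμy' : walkMeasure G r α x y ≤ 1 - α := by
    rw [hμy]; exact mul_le_of_le_one_right (by linarith) ha
  have hνx' : walkMeasure G r α y x ≤ 1 - α := by
    rw [hνx]; exact mul_le_of_le_one_right (by linarith) hb
  -- Height along the geodesics x', x, y, y': the values are 2, 1, 0, -1.
  let f : V → ℝ := fun z => if z = x then 1 else if z = y then 0 else if G.Adj x z then 2 else -1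
  have fx : f x = 1 := if_pos rfl
  have fy : f y = 0 := by simp [f, h.ne']
  have fx' : ∀ z, G.Adj x z → z ≠ y → f z = 2 := fun z hz hzy => by simp [f, hz.ne', hzy, hz]
  have fy' : ∀ z, G.Adj y z → z ≠ x → f z = -1 := fun z hz hzx => by
    have : ¬ G.Adj x z := fun hz' => not_triangle_of_egirth hg h hz hz'.symm
    simp [f, hzx, hz.ne', this]
  have hsupp : ∀ u, walkMeasure G r α x u ≠ 0 → u = x ∨ u = y ∨ (G.Adj x u ∧ u ≠ y) := by
    intro u hu
    rcases eq_or_adj_of_walkMeasure_ne_zero hu with h1 | h1 <;> tauto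
  have hsupp' : ∀ v, walkMeasure G r α y v ≠ 0 → v = y ∨ v = x ∨ (G.Adj y v ∧ v ≠ x) := by
    intro v hv
    rcases eq_or_adj_of_walkMeasure_ne_zero hv with h1 | h1 <;> tauto
  have d1 : ∀ {u v : V}, G.Adj u v → (G.dist u v : ℝ) = 1 := fun huv => by
    exact_mod_cast SimpleGraph.dist_eq_one_iff_adj.2 huv
  rw [wasserstein_eq_of_tight h.ne (walkMeasure_nonneg r (by linarith) hα1.le x)
    (walkMeasure_nonneg r (by linarith) hα1.le y) (sum_walkMeasure hG r α x)
    (sum_walkMeasure hG r α y) (by rw [walkMeasure_self]; linarith)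
    (by rw [walkMeasure_self]; linarith) (by linarith) f]
  -- The shift by 2 (in `e2`, by -1) cancels the other neighbours, leaving only the terms at x and
  -- y.
  · have e1 : ∑ u, (f u - 2) * walkMeasure G r α x u = -α - 2 * walkMeasure G r α x y := by
      rw [Finset.sum_eq_add x y h.ne (fun u _ hu => ?_)
        (fun h' => absurd (Finset.mem_univ _) h') (fun h' => absurd (Finset.mem_univ _) h'),
        fx, fy, walkMeasure_self]
      · ring
      · by_contra hne
        obtain ⟨h1, h2⟩ := mul_ne_zero_iff.1 hne
        rcases hsupp u h2 with h3 | h3 | h3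
        · exact hu.1 h3
        · exact hu.2 h3
        · exact h1 (by rw [fx' u h3.1 h3.2, sub_self])
    have e2 : ∑ v, (f v + 1) * walkMeasure G r α y v = 2 * walkMeasure G r α y x + α := by
      rw [Finset.sum_eq_add x y h.ne (fun u _ hu => ?_)
        (fun h' => absurd (Finset.mem_univ _) h') (fun h' => absurd (Finset.mem_univ _) h'),
        fx, fy, walkMeasure_self]
      · ring
      · by_contra hne
        obtain ⟨h1, h2⟩ := mul_ne_zero_iff.1 hne
        rcases hsupp' u h2 with h3 | h3 | h3
        · exact hu.2 h3
        · exact hu.1 h3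
        · exact h1 (by rw [fy' u h3.1 h3.2, neg_add_cancel])
    simp only [sub_mul, add_mul, Finset.sum_sub_distrib, Finset.sum_add_distrib,
      ← Finset.mul_sum, sum_walkMeasure hG] at e1 e2
    rw [curvature_mk r h]
    linarith
  · intro u v hu hv
    rcases hsupp u hu with rfl | rfl | ⟨hxu, huy⟩ <;>
      rcases hsupp' v hv with rfl | rfl | ⟨hyv, hvx⟩
    · rw [fx, fy, d1 h]; norm_num
    · simp
    · rw [fx, fy' v hyv hvx]
      have := two_le_dist hconn hvx.symm fun h' => not_triangle_of_egirth hg h hyv h'.symm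
      have : (2 : ℝ) ≤ G.dist u v := by exact_mod_cast this
      linarith
    · simp
    · rw [fx, fy, d1 h.symm]; norm_num
    · rw [fy, fy' v hyv hvx, d1 hyv]; norm_num
    · rw [fx' u hxu huy, fy]
      have := two_le_dist hconn huy fun h' => not_triangle_of_egirth hg h h'.symm hxu.symm
      have : (2 : ℝ) ≤ G.dist u v := by exact_mod_cast this
      linarith
    · rw [fx' u hxu huy, fx, d1 hxu.symm]; norm_num
    · rw [fx' u hxu huy, fy' v hyv hvx]
      have : (3 : ℝ) ≤ G.dist u v := by
        exact_mod_cast three_le_dist hconn hg h hxu hyv huy hvx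
      linarith
  · intro u v hu hv huy hvx
    have h1 : (G.dist u x : ℝ) ≤ f u - 1 := by
      rcases hsupp u hu with rfl | rfl | ⟨hxu, huy⟩
      · simp [fx]
      · exact absurd rfl huy
      · rw [fx' u hxu huy, d1 hxu.symm]; norm_num
    have h2 : (G.dist y v : ℝ) ≤ -f v := by
      rcases hsupp' v hv with rfl | rfl | ⟨hyv, hvx⟩
      · simp [fy]
      · exact absurd rfl hvx
      · rw [fy' v hyv hvx, d1 hyv]; norm_num
    have h3 : (G.dist u v : ℝ) ≤ G.dist u x + (G.dist x y + G.dist y v) := by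
      exact_mod_cast (hconn.dist_triangle (u := u) (v := x) (w := v)).trans
        (Nat.add_le_add_left hconn.dist_triangle _)
    rw [d1 h] at h3
    linarith

theorem hasLinLuYauCurvature (hG : ∀ v : V, ∃ e : G.edgeSet, v ∈ e.1) (hconn : G.Connected)
    (hg : 6 ≤ G.egirth) (r : G.edgeSet → ℝ) {x y : V} (h : G.Adj x y) :
    HasLinLuYauCurvature G r x y (curvature G r ⟨s(x, y), h⟩) := by
  refine tendsto_const_nhds.congr' ?_
  filter_upwards [Ioo_mem_nhdsLT (show (1 / 2 : ℝ) < 1 by norm_num)] with α hα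
  have h1 : 1 - α ≠ 0 := (sub_pos.2 hα.2).ne'
  rw [wasserstein_walkMeasure hG hconn hg r h hα, SimpleGraph.dist_eq_one_iff_adj.2 h]
  field_simp
  simp

end LinLuYau

end CalabiFlow

theorem theorem1p1 {V : Type*} [Fintype V] [DecidableEq V] (G : SimpleGraph V)
    [DecidableRel G.Adj] (hconn : G.Connected) (hgirth : 6 ≤ G.egirth)
    (κs : G.edgeSet → ℝ)
    (hκs : ∑ e, κs e = 2 * ((Fintype.card V : ℝ) - (Fintype.card G.edgeSet : ℝ)))
    (r₀ : G.edgeSet → ℝ) :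
    -- the curvature is the Lin-Lu-Yau curvature of the weighted graph
    (∀ (r : G.edgeSet → ℝ) (x y : V) (h : G.Adj x y),
      CalabiFlow.HasLinLuYauCurvature G r x y (CalabiFlow.curvature G r ⟨s(x, y), h⟩)) ∧
    -- the equivalence, for the flows that start at `r₀`
    List.TFAE [
      ∃ rs, CalabiFlow.curvature G rs = κs,
      ∃ rs, CalabiFlow.ConvergesExpTo (CalabiFlow.calabiField G κs) r₀ rs,
      ∀ s : ℝ, ∃ rs, CalabiFlow.ConvergesExpTo (CalabiFlow.fracCalabiField G s κs) r₀ rs,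
      ∀ p : ℝ, 1 < p → ∃ rs, CalabiFlow.ConvergesTo (CalabiFlow.pCalabiField G p κs) r₀ rs] ∧
    -- the limit is the same `rs` throughout, namely the weight that realizes `κs`, normalized by
    -- a global factor so that the sum of its logarithms is that of the initial weight
    ∀ rs : G.edgeSet → ℝ, ∑ e, rs e = ∑ e, r₀ e →
      List.TFAE [
        CalabiFlow.curvature G rs = κs,
        CalabiFlow.ConvergesExpTo (CalabiFlow.calabiField G κs) r₀ rs,
        ∀ s : ℝ, CalabiFlow.ConvergesExpTo (CalabiFlow.fracCalabiField G s κs) r₀ rs,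
        ∀ p : ℝ, 1 < p → CalabiFlow.ConvergesTo (CalabiFlow.pCalabiField G p κs) r₀ rs] := by
  -- Without edges both sums in `hκs` would be empty while |V| > 0, which is contradictory.
  have hne : Nonempty G.edgeSet := by
    by_contra hemp
    rw [not_nonempty_iff] at hemp
    have hV : 0 < Fintype.card V := Fintype.card_pos_iff.2 hconn.nonempty
    simp at hκs
    omega
  have hG := CalabiFlow.exists_mem_edge hconn hne.some
  have calabi : ∀ {rs}, CalabiFlow.ConvergesTo (CalabiFlow.calabiField G κs) r₀ rs →
      CalabiFlow.curvature G rs = κs :=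
    CalabiFlow.curvature_eq_of_convergesTo_calabiField hG hconn hκs
  have e1 := CalabiFlow.fracCalabiField_one hG κs
  have e2 := CalabiFlow.pCalabiField_two hG κs
  refine ⟨fun r x y h => CalabiFlow.hasLinLuYauCurvature hG hconn hgirth r h, ?_,
    fun rs hsum => ?_⟩
  · tfae_have 1 → 3 := fun ⟨rs, hrs⟩ s => by
      obtain ⟨rs, hrs, hsum⟩ := CalabiFlow.exists_normalized hrs r₀
      exact ⟨rs, CalabiFlow.convergesExpTo_fracCalabiField hG hconn hκs hrs hsum s⟩
    tfae_have 3 → 2 := fun h => e1 ▸ h 1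
    tfae_have 2 → 1 := fun ⟨rs, h⟩ => ⟨rs, calabi h.convergesTo⟩
    tfae_have 1 → 4 := fun ⟨rs, hrs⟩ p hp => by
      obtain ⟨rs, hrs, hsum⟩ := CalabiFlow.exists_normalized hrs r₀
      exact ⟨rs, CalabiFlow.convergesTo_pCalabiField hG hconn hκs hrs hsum hp⟩
    tfae_have 4 → 1 := fun h => by
      obtain ⟨rs, hrs⟩ := h 2 one_lt_two
      exact ⟨rs, calabi (e2 ▸ hrs)⟩
    tfae_finish
  · tfae_have 1 → 3 := fun hrs =>
      CalabiFlow.convergesExpTo_fracCalabiField hG hconn hκs hrs hsum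
    tfae_have 3 → 2 := fun h => e1 ▸ h 1
    tfae_have 2 → 1 := fun h => calabi h.convergesTo
    tfae_have 1 → 4 := fun hrs p hp =>
      CalabiFlow.convergesTo_pCalabiField hG hconn hκs hrs hsum hp
    tfae_have 4 → 1 := fun h => calabi (e2 ▸ h 2 one_lt_two)
    tfae_finish
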